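/- Let $d\ge 1$. Let $\Lambda_L$ be the first order language of bounded lattices with involution (symbols $0,+,{}^\perp$), $\Lambda_F$ the language of $*$-rings with constants $0,1$, and $\Lambda_F^+$ its extension by constants $c_1,\dots,c_d$. An inner product space over a field $F$ with involution ${}^*$ is a vector space $V$ over $F$, here of dimension $d$, with a non-alternate, non-degenerate $*$-hermitean form $\langle\cdot|\cdot\rangle$. Its lattice ${\sf L}={\sf L}(V)$ of subspaces, with $0$, join $U_1+U_2$ and $U\mapsto U^\perp$, is a structure for $\Lambda_L$. For an orthogonal basis $\bar v=(v_1,\dots,v_d)$ put $|v_i|=\langle v_i|v_i\rangle$ and $|\bar v|=(1,|v_1|^{-1}|v_2|,\dots,|v_1|^{-1}|v_d|)$. A tuple $\bar\alpha\in F^d$ is admissible if $\alpha_1=1$, $\alpha_i=\alpha_i^*\ne0$ for all $i$, and $\bar\alpha=|\bar v|$ for some orthogonal basis $\bar v$ of $V$; the constants $c_i$ are then interpreted as $\alpha_i$. For $M\subseteq{\sf L}^n$ let $\theta_{L\bar\alpha F}(M)$ be the set of all $(A_1,\dots,A_n)\in(F^{d\times d})^n$ such that, for some orthogonal basis $\bar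 v$ with $|\bar v|=\bar\alpha$, the tuple of the subspaces spanned by the columns of $A_1,\dots,A_n$ (read as coordinate vectors with respect to $\bar v$) belongs to $M$. For $k\le d$ and a strictly increasing $f:\{1,\dots,k\}\to\{1,\dots,d\}$ (write $|f|=k$), a $d\times d$-matrix is in $f$-weak normal form if a nonzero multiple of it is in reduced column echelon form with pivots in the positions $(f(j),j)$, $j\le k$. For every fixed $d$ there exist (1) a map $\tau$ taking each formula $\varphi(x_1,\dots,x_n)$ of $\Lambda_L$ to a formula $\tau(\varphi)(X_1,\dots,X_n)$ of $\Lambda_F^+$, where the $X_k$ are $d\times d$-matrices of variables, such that: $\tau(\varphi)$ is quantifier free if $\varphi$ is; for all $F$, all $d$-dimensional inner product spaces $V$ over $F$ and all admissible $\bar\alpha$, if $\varphi$ defines $M\subseteq{\sf L}(V)^n$ then $\tau(\varphi)$ defines $\theta_{L\bar\alpha F}(M)$; and for every $F$ and every $\bar\alpha\in F_0^d$, where $F_0$ is the prime subfield of $F$, each $\tau(\varphi)$, with $\bar c$ interpreted as $\bar\alpha$, is equivalent in $F$ to a formula of $\Lambda_F$, which is quantifier free if $\varphi$ is; (2) for each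 $f$ a finite set $\Sigma^{f}$ of formulas $\sigma(X)$ of $\Lambda_F$, each a conjunction of equations $p=0$ and inequations $q\neq0$ between terms, in a $d\times d$-matrix $X$ of variables, and for each $\sigma\in\Sigma^f$ a $d\times d$-matrix $P^{\sigma f}(X)$ of $\Lambda_F$-terms, such that for all $F$ and all $A\in F^{d\times d}$: $\sigma(A)$ holds for some $f$ and some $\sigma\in\Sigma^f$; and whenever $\sigma\in\Sigma^f$ and $\sigma(A)$ holds, $P^{\sigma f}(A)$ is in $f$-weak normal form and has the same column span as $A$; such that the following holds, where $\delta_h(X)$ (for $h\le d$) is the quantifier free formula $\bigvee_{|f|=h}\bigvee_{\sigma\in\Sigma^f}\sigma(X)$ of $\Lambda_F$. Let $V$ be any $d$-dimensional inner product space over any field $F$ with involution, $\bar\alpha$ admissible, $\underline d=(d_1,\dots,d_n)$ with all $d_k\le d$, and ${\sf L}^{\underline d}=\{\bar u\in{\sf L}(V)^n\mid \dim u_k=d_k \text{ for all } k\}$. If $\varphi(\bar x)$ in $\Lambda_L$ defines $M\subseteq{\sf L}(V)^n$, then $\theta_{L\bar\alpha F}(M\cap{\sf L}^{\underline d})$ is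 defined by $$\tau(\varphi)(\bar X)\wedge\bigwedge_{k=1}^n\delta_{d_k}(X_k);$$ if $\bar\alpha\in F_0^d$, here $\tau(\varphi)$ may be replaced by a formula of $\Lambda_F$ equivalent to it in $F$ as in (1). In particular, if $N$ is quantifier free definable relatively to ${\sf L}^{\underline d}$, that is $N=M\cap{\sf L}^{\underline d}$ for some $M\subseteq{\sf L}(V)^n$ defined by a quantifier free formula, then $\theta_{L\bar\alpha F}(N)$ is defined within $(F^{d\times d})^n$ by a quantifier free formula of $\Lambda_F^+$, and even of $\Lambda_F$ if $\bar\alpha\in F_0^d$. -/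

import Mathlib

open scoped FirstOrder

universe u v

namespace SubspaceLattice

open FirstOrder FirstOrder.Language

/-! ### The first order languages -/

/-- Operation symbols of bounded lattices with involution: `0`, the involution, the join.
(Meet and `1` are the derived terms `(s^⊥ + t^⊥)^⊥` and `0^⊥`.) -/
inductive LatFunc : ℕ → Type
  | zero : LatFunc 0
  | perp : LatFunc 1
  | join : LatFunc 2

/-- The language `Λ_L` of bounded lattices with involution. -/
def latLang : FirstOrder.Language.{0, 0} := ⟨LatFunc, fun _ => Empty⟩

/-- Operation symbols of `*`-rings. -/
inductive StarRingFunc : ℕ → Type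
  | zero : StarRingFunc 0
  | one : StarRingFunc 0
  | neg : StarRingFunc 1
  | star : StarRingFunc 1
  | add : StarRingFunc 2
  | mul : StarRingFunc 2

/-- The language `Λ_F` of `*`-rings with constants `0`, `1`. -/
def starLang : FirstOrder.Language.{0, 0} := ⟨StarRingFunc, fun _ => Empty⟩

/-- The language `Λ_F⁺`: `Λ_F` with additional constants `c_1, …, c_d`. -/
abbrev starLangPlus (d : ℕ) : FirstOrder.Language.{0, 0} := starLang[[Fin d]]

/-- A `*`-field as a structure for `Λ_F`. -/
@[reducible]
def starStructure (F : Type u) [Field F] [StarRing F] : starLang.Structure F where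
  funMap := fun {_} f =>
    match f with
    | StarRingFunc.zero => fun _ => 0
    | StarRingFunc.one => fun _ => 1
    | StarRingFunc.neg => fun x => -(x 0)
    | StarRingFunc.star => fun x => star (x 0)
    | StarRingFunc.add => fun x => x 0 + x 1
    | StarRingFunc.mul => fun x => x 0 * x 1
  RelMap := fun {_} r => r.elim

/-- `F ⊨ ψ(a)` for a formula `ψ` of `Λ_F`. -/
def Sat {F : Type u} [Field F] [StarRing F] {γ : Type} (ψ : starLang.Formula γ) (a : γ → F) :
    Prop :=
  letI := starStructure F
  ψ.Realize a

/-- `F ⊨ ψ(a)` for a formula `ψ` of `Λ_F⁺`, the constant `c_i` being interpreted as `α i`. -/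
def SatPlus {F : Type u} [Field F] [StarRing F] {d : ℕ} (α : Fin d → F) {γ : Type}
    (ψ : (starLangPlus d).Formula γ) (a : γ → F) : Prop :=
  letI := starStructure F
  letI := constantsOn.structure α
  ψ.Realize a

/-- The value in `F` of a term of `Λ_F`. -/
def termVal {F : Type u} [Field F] [StarRing F] {γ : Type} (t : starLang.Term γ) (a : γ → F) : F :=
  letI := starStructure F
  t.realize a

/-! ### Inner product spaces and their subspace lattices -/

section Space

variable {F : Type u} [Field F] [StarRing F] {V : Type v} [AddCommGroup V] [Module F V]

/-- `⟨x | y⟩ = B x y` is a non-alternate non-degenerate `*`-hermitean form on `V`. -/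
structure IsInnerProduct (B : V →ₗ⋆[F] V →ₗ[F] F) : Prop where
  hermitean : ∀ x y, B y x = star (B x y)
  nonAlternate : ∃ x, B x x ≠ 0
  nonDegenerate : ∀ y, (∀ x, B x y = 0) → y = 0

/-- The orthogonal `U^⊥ = {x | ∀ u ∈ U, ⟨x | u⟩ = 0}` of a subspace with respect to a
`*`-hermitean form is Mathlib's `Submodule.orthogonalBilin`. -/
theorem mem_orthogonal_iff {B : V →ₗ⋆[F] V →ₗ[F] F} (hB : IsInnerProduct B)
    (U : Submodule F V) (x : V) : x ∈ U.orthogonalBilin B ↔ ∀ y ∈ U, B x y = 0 := by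
  rw [Submodule.mem_orthogonalBilin_iff]
  refine forall₂_congr fun y _ => ?_
  rw [hB.hermitean x y, star_eq_zero]

/-- The lattice `L(V)` of all linear subspaces of `V`, with join `U₁ + U₂` and the involution
`U ↦ U^⊥`, as a structure for `Λ_L`. -/
@[reducible]
def latStructure (B : V →ₗ⋆[F] V →ₗ[F] F) : latLang.Structure (Submodule F V) where
  funMap := fun {_} f =>
    match f with
    | LatFunc.zero => fun _ => ⊥
    | LatFunc.perp => fun x => (x 0).orthogonalBilin B
    | LatFunc.join => fun x => x 0 ⊔ x 1
  RelMap := fun {_} r => r.elim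

/-- The relation `M ⊆ L(V)^n` defined by a formula `φ(x_1, …, x_n)` of `Λ_L`. -/
def latRel (B : V →ₗ⋆[F] V →ₗ[F] F) {n : ℕ} (φ : latLang.Formula (Fin n)) :
    Set (Fin n → Submodule F V) :=
  {U | letI := latStructure B; φ.Realize U}

/-- The set `L^d̲` of all `n`-tuples of subspaces with prescribed dimensions. -/
def dimTuples (F : Type u) [Field F] (V : Type v) [AddCommGroup V] [Module F V] {n : ℕ}
    (dd : Fin n → ℕ) : Set (Fin n → Submodule F V) :=
  {U | ∀ k, Module.finrank F (U k) = dd k}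

/-- `N` is quantifier free definable relatively to `L^d̲`. -/
def QFDefinableRel (B : V →ₗ⋆[F] V →ₗ[F] F) {n : ℕ} (dd : Fin n → ℕ)
    (N : Set (Fin n → Submodule F V)) : Prop :=
  ∃ φ : latLang.Formula (Fin n), φ.IsQF ∧ N = latRel B φ ∩ dimTuples F V dd

/-- `b` is an orthogonal basis. -/
def IsPerpBasis (B : V →ₗ⋆[F] V →ₗ[F] F) {d : ℕ} (b : Module.Basis (Fin d) F V) : Prop :=
  ∀ i j, i ≠ j → B (b i) (b j) = 0

/-- `|v̄| = (1, |v_1|⁻¹|v_2|, …, |v_1|⁻¹|v_d|)`, where `|v| = ⟨v | v⟩`.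
(The first entry is `1` since `|v_1| ≠ 0` for an orthogonal basis of an inner product space.) -/
noncomputable def basisForm (B : V →ₗ⋆[F] V →ₗ[F] F) {d : ℕ} [NeZero d] (b : Module.Basis (Fin d) F V) :
    Fin d → F :=
  fun i => (B (b 0) (b 0))⁻¹ * B (b i) (b i)

/-- `ᾱ` is admissible with respect to `V`. -/
def Admissible (B : V →ₗ⋆[F] V →ₗ[F] F) {d : ℕ} [NeZero d] (α : Fin d → F) : Prop :=
  α 0 = 1 ∧ (∀ i, star (α i) = α i ∧ α i ≠ 0) ∧
    ∃ b : Module.Basis (Fin d) F V, IsPerpBasis B b ∧ basisForm B b = α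

/-- The span of the columns of `A` if `V` is identified with `F^d` via the basis `b`. -/
noncomputable def spanVia {d : ℕ} (b : Module.Basis (Fin d) F V) (A : Matrix (Fin d) (Fin d) F) :
    Submodule F V :=
  Submodule.span F (Set.range fun j => ∑ i, A i j • b i)

/-- `θ_{L v̄ F}(M)`: all tuples of matrices related to some member of `M`, that is,
whose column spans with respect to `b` form a tuple in `M`. -/
def thetaBasis {d n : ℕ} (b : Module.Basis (Fin d) F V) (M : Set (Fin n → Submodule F V)) :
    Set (Fin n → Matrix (Fin d) (Fin d) F) :=
  {A | ∃ U ∈ M, U = fun k => spanVia b (A k)}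

/-- `θ_{L ᾱ F}(M)`: the union of the `θ_{L v̄ F}(M)` over all orthogonal bases `v̄` of `V`
with `|v̄| = ᾱ`. -/
def theta (B : V →ₗ⋆[F] V →ₗ[F] F) {d n : ℕ} [NeZero d] (α : Fin d → F)
    (M : Set (Fin n → Submodule F V)) : Set (Fin n → Matrix (Fin d) (Fin d) F) :=
  {A | ∃ b : Module.Basis (Fin d) F V,
    IsPerpBasis B b ∧ basisForm B b = α ∧ A ∈ thetaBasis b M}

end Space

/-! ### Relations on matrices -/

/-- The variables `x_{kij}` forming `n` matrices `X_1, …, X_n` of size `d × d`. -/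
abbrev MatVar (n d : ℕ) : Type := Fin n × Fin d × Fin d

section Matrices

variable {F : Type u} [Field F] [StarRing F]

/-- A tuple of matrices as an assignment of values to the variables `x_{kij}`. -/
def matVal {n d : ℕ} (A : Fin n → Matrix (Fin d) (Fin d) F) : MatVar n d → F :=
  fun p => A p.1 p.2.1 p.2.2

/-- The relation on `F^{d × d}` defined by a formula `ψ(X_1, …, X_n)` of `Λ_F⁺`,
the constants being interpreted by `ᾱ`. -/
def matRelPlus {n d : ℕ} (α : Fin d → F) (ψ : (starLangPlus d).Formula (MatVar n d)) :
    Set (Fin n → Matrix (Fin d) (Fin d) F) :=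
  {A | SatPlus α ψ (matVal A)}

/-- The relation on `F^{d × d}` defined by a formula `ψ(X_1, …, X_n)` of `Λ_F`. -/
def matRel {n d : ℕ} (ψ : starLang.Formula (MatVar n d)) :
    Set (Fin n → Matrix (Fin d) (Fin d) F) :=
  {A | Sat ψ (matVal A)}

/-- `A` is in (reduced) column echelon normal form with pivots in the positions `(f j, j)`:
pivots are `1`, entries above a pivot in its column vanish, a pivot is the only nonzero
entry in its row, and only the first `k` columns are nonzero. -/
def IsNF {d k : ℕ} (f : Fin k ↪o Fin d) (A : Matrix (Fin d) (Fin d) F) : Prop :=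
  (∀ (j : Fin k) (h : Fin d), h.val = j.val → A (f j) h = 1 ∧ ∀ i, i < f j → A i h = 0) ∧
  (∀ (j : Fin k) (h : Fin d), h.val ≠ j.val → A (f j) h = 0) ∧
  (∀ h : Fin d, k ≤ h.val → ∀ i, A i h = 0)

/-- Weak normal form: some nonzero scalar multiple is in normal form. -/
def IsWeakNF {d k : ℕ} (f : Fin k ↪o Fin d) (A : Matrix (Fin d) (Fin d) F) : Prop :=
  ∃ r : F, r ≠ 0 ∧ IsNF f (r • A)

end Matrices

/-! ### Case distinctions of the computation of normal forms, and the rank conditions -/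

/-- The constant `0` as a term of `Λ_F`. -/
def zeroTerm {γ : Type} : starLang.Term γ :=
  Term.func (L := starLang) (l := 0) StarRingFunc.zero Fin.elim0

/-- A basic formula of `Λ_F`: a conjunction of formulas `p = 0` and `q ≠ 0`.
(Every term of `Λ_F` is a `*`-polynomial with integer coefficients.) -/
def IsBasic {γ : Type} (σ : starLang.Formula γ) : Prop :=
  ∃ ps qs : List (starLang.Term γ),
    σ = (ps.map (fun p => p.equal zeroTerm) ++
      qs.map (fun q => (q.equal zeroTerm).not)
      ).foldr (· ⊓ ·) ⊤

/-- For all pivot positions `f` a finite set `Σ^f` of formulas of `Λ_F` in a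
`d × d`-matrix of variables. -/
abbrev CaseSystem (d : ℕ) : Type :=
  ∀ k : ℕ, (Fin k ↪o Fin d) → Finset (starLang.Formula (Fin d × Fin d))

/-- For all pivot positions `f` and formulas `σ` a `d × d`-matrix `P^{σ f}` of terms of `Λ_F` in
a `d × d`-matrix of variables. -/
abbrev OutputSystem (d : ℕ) : Type :=
  ∀ k : ℕ, (Fin k ↪o Fin d) → starLang.Formula (Fin d × Fin d) →
    Matrix (Fin d) (Fin d) (starLang.Term (Fin d × Fin d))

/-- The sets `S k f` of basic formulas and the matrices `P k f σ` of terms describe the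
computation of normal forms of `d × d`-matrices over every `*`-field: each matrix `A` satisfies
some `σ ∈ S k f`, and for each such `σ` the matrix `P k f σ`, evaluated at `A`, is in weak normal
form with pivot positions `f` and has the same column span as `A`. -/
def ComputesNF {d : ℕ} (S : CaseSystem d) (P : OutputSystem d) : Prop :=
  (∀ k f, ∀ σ ∈ S k f, IsBasic σ) ∧
  ∀ (F : Type u) [Field F] [StarRing F] (A : Matrix (Fin d) (Fin d) F),
    (∃ k f, ∃ σ ∈ S k f, Sat σ (fun p => A p.1 p.2)) ∧
    ∀ k f, ∀ σ ∈ S k f, Sat σ (fun p => A p.1 p.2) →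
      IsWeakNF f (Matrix.of fun i j => termVal (P k f σ i j) (fun p => A p.1 p.2)) ∧
      Submodule.span F (Set.range
        (Matrix.of fun i j => termVal (P k f σ i j) (fun p => A p.1 p.2)).col) =
        Submodule.span F (Set.range A.col)

/-- The rank condition `δ_h(X)`: the disjunction of all `σ(X) ∈ Σ^f` with `|f| = h`. -/
noncomputable def rankCond {d : ℕ} (S : CaseSystem d) (h : ℕ) :
    starLang.Formula (Fin d × Fin d) :=
  Formula.iSup (fun p : (Σ f : Fin h ↪o Fin d, {σ // σ ∈ S h f}) => p.2.1)

/-- The conjunction `⋀_k δ_{d_k}(X_k)`. -/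
noncomputable def rankConds {n d : ℕ} (S : CaseSystem d) (dd : Fin n → ℕ) :
    starLang.Formula (MatVar n d) :=
  Formula.iInf (fun k : Fin n => (rankCond S (dd k)).relabel (fun p => (k, p.1, p.2)))

/-- A formula of `Λ_F` considered as a formula of `Λ_F⁺`. -/
def toPlus {d : ℕ} {γ : Type} (ψ : starLang.Formula γ) : (starLangPlus d).Formula γ :=
  (starLang.lhomWithConstants (Fin d)).onFormula ψ

/-! ### Translations -/

/-- Maps from formulas `φ(x_1, …, x_n)` of `Λ_L` to formulas `ψ(X_1, …, X_n)` of `Λ_F⁺`. -/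
abbrev FormulaMap (d : ℕ) : Type :=
  ∀ n : ℕ, latLang.Formula (Fin n) → (starLangPlus d).Formula (MatVar n d)

/-- `τ` is a translation `τ_{L c̄ F}`, uniform for all `d`-dimensional inner product spaces:
it preserves quantifier freeness, for all `V` and all admissible `ᾱ` it takes a definition of
`M` to a definition of `θ_{L ᾱ F}(M)`, and if all `α_i` are in the prime subfield then the
translated formula, with `c̄` interpreted as `ᾱ`, can be taken in `Λ_F`. -/
def IsTranslation {d : ℕ} [NeZero d] (τ : FormulaMap d) : Prop :=
  (∀ n φ, φ.IsQF → (τ n φ).IsQF) ∧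
  (∀ (F : Type u) [Field F] [StarRing F] (V : Type v) [AddCommGroup V] [Module F V]
    (B : V →ₗ⋆[F] V →ₗ[F] F), IsInnerProduct B → Module.finrank F V = d →
    ∀ α : Fin d → F, Admissible B α → ∀ n φ,
      theta B α (latRel B φ) = matRelPlus α (τ n φ)) ∧
  (∀ (F : Type u) [Field F] [StarRing F] (α : Fin d → F), (∀ i, α i ∈ (⊥ : Subfield F)) →
    ∀ n φ, ∃ ψ : starLang.Formula (MatVar n d), (φ.IsQF → ψ.IsQF) ∧
      ∀ a : MatVar n d → F, Sat ψ a ↔ SatPlus α (τ n φ) a)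

end SubspaceLattice

open SubspaceLattice

namespace SubspaceLattice

open FirstOrder FirstOrder.Language

/-! ### Pivotal minors and normal forms of matrices -/

section Minors

open Matrix

variable {F : Type u} [Field F] {m ι : Type}

/-! An orthogonal basis with `|v̄| = ᾱ` carries `V` to `F^d` with the form `diagForm α`, up to the
nonzero factor `|v_1|`. A scalar does not affect orthogonality, so the lattice with involution
depends on `ᾱ` only, and so does the truth of a lattice formula on column spans (`mem_latRel_iff`).

In `F^d` a subspace is encoded by `δ ≠ 0` and a matrix `E` such that `δ⁻¹ E` is some projection onto
it (`IsScaledProj`). Cramer's rule yields such data for a column span without division, once a minor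
of full rank is known, and finitely many quantifier free cases decide which minor serves. Sums are
column spans of concatenated matrices, orthogonals come from the adjoint projection, and inclusion
is the identity `E * E' = δ • E'`. Hence an equation of lattice terms becomes a quantifier free
formula, and a quantifier over subspaces becomes `d²` quantifiers over entries
(`exists_translation`). Constants from the prime field are fractions of integers, whose denominators
are cleared equation by equation.

Among the nonsingular choices of rows, the one with least index sum puts the minors in echelon form
(`exists_echelon`). The number of pivots is the dimension of the column span, so `rankCond`
expresses the dimension and restricting dimensions amounts to a conjunction. -/

/-- The matrix whose `(i, j)` entry is the minor of `A` with columns `g` and rows `f`, the `j`-th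
row being replaced by the `i`-th. -/
def minorMatrix (A : Matrix m ι F) {k : ℕ} (f : Fin k → m) (g : Fin k → ι) :
    Matrix m (Fin k) F :=
  Matrix.of fun i j => (A.submatrix (Function.update f j i) g).det

/-- Cramer's rule: expanding the determinant along the replaced row gives the entries of the
adjugate. -/
theorem minorMatrix_eq (A : Matrix m ι F) {k : ℕ} (f : Fin k → m) (g : Fin k → ι) :
    minorMatrix A f g = A.submatrix id g * (A.submatrix f g).adjugate := by
  ext i j
  have h : A.submatrix (Function.update f j i) g =
      (A.submatrix f g).updateRow j (fun c => A i (g c)) := by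
    ext r c
    by_cases hr : r = j
    · subst hr; simp
    · simp [hr]
  rw [minorMatrix, of_apply, h, mul_apply, ← det_transpose, ← updateCol_transpose, ← cramer_apply,
    cramer_eq_adjugate_mulVec, mulVec, dotProduct]
  refine Finset.sum_congr rfl fun l _ => ?_
  rw [← adjugate_transpose, transpose_apply, mul_comm]
  rfl

/-- Since `M * adjugate M = det M • 1`, the rows `f` carry a multiple of the identity; these will be
the pivots. -/
theorem minorMatrix_submatrix (A : Matrix m ι F) {k : ℕ} (f : Fin k → m) (g : Fin k → ι) :
    (minorMatrix A f g).submatrix f id = (A.submatrix f g).det • 1 := by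
  rw [minorMatrix_eq, ← mul_adjugate]
  rfl

/-- The rows `f` and the columns `g` of `A` form a nonsingular matrix of the same rank
as `A`. -/
def IsPivotal (A : Matrix m ι F) {k : ℕ} (f : Fin k → m) (g : Fin k → ι) : Prop :=
  (A.submatrix f g).det ≠ 0 ∧
    ∀ i c, (A.submatrix f g).det * A i c = ∑ j, minorMatrix A f g i j * A (f j) c

/-- The minors combine the columns `g` with adjugate coefficients. Conversely, the pivotal identity
divided by the determinant recovers every column of `A`. -/
theorem IsPivotal.span_col {A : Matrix m ι F} {k : ℕ} {f : Fin k → m} {g : Fin k → ι}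
    (h : IsPivotal A f g) :
    Submodule.span F (Set.range (minorMatrix A f g).col) = Submodule.span F (Set.range A.col) := by
  apply le_antisymm
  · rw [Submodule.span_le]
    rintro _ ⟨j, rfl⟩
    have : (minorMatrix A f g).col j = ∑ l, (A.submatrix f g).adjugate l j • A.col (g l) := by
      ext i
      simp [minorMatrix_eq, mul_apply, mul_comm]
    rw [this]
    exact Submodule.sum_mem _ fun l _ => Submodule.smul_mem _ _ (Submodule.subset_span ⟨_, rfl⟩)
  · rw [Submodule.span_le]
    rintro _ ⟨c, rfl⟩
    have : A.col c = (A.submatrix f g).det⁻¹ • ∑ j, A (f j) c • (minorMatrix A f g).col j := by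
      ext i
      simp only [Pi.smul_apply, smul_eq_mul, Finset.sum_apply, col_apply]
      rw [eq_inv_mul_iff_mul_eq₀ h.1, h.2]
      simp [mul_comm]
    rw [this]
    exact Submodule.smul_mem _ _ (Submodule.sum_mem _ fun l _ =>
      Submodule.smul_mem _ _ (Submodule.subset_span ⟨_, rfl⟩))

/-- Nonsingular square submatrices whose columns span the column space are pivotal. -/
theorem isPivotal_of_span {A : Matrix m ι F} {k : ℕ} {f : Fin k → m} {g : Fin k → ι}
    (hdet : (A.submatrix f g).det ≠ 0)
    (hspan : ∀ c, A.col c ∈ Submodule.span F (Set.range (A.col ∘ g))) : IsPivotal A f g := by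
  refine ⟨hdet, fun i c => ?_⟩
  obtain ⟨x, hx⟩ := (Submodule.mem_span_range_iff_exists_fun F).1 (hspan c)
  have hA : ∀ r, A r c = (A.submatrix id g *ᵥ x) r := by
    intro r
    have := congrFun hx r
    simp only [Finset.sum_apply, Pi.smul_apply, smul_eq_mul, Function.comp, col_apply] at this
    rw [← this]
    simp [mulVec, dotProduct, mul_comm]
  have h1 : (fun j => A (f j) c) = A.submatrix f g *ᵥ x := funext fun j => hA (f j)
  have h2 : ∑ j, minorMatrix A f g i j * A (f j) c =
      (minorMatrix A f g *ᵥ fun j => A (f j) c) i := rfl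
  -- With `M` the chosen minor and column `c` written as `A_g x`, the sum is the `i`-th entry of
  -- `A_g (adjugate M * M) x = det M • A_g x`.
  rw [h2, h1, minorMatrix_eq, mulVec_mulVec, Matrix.mul_assoc, adjugate_mul, hA i]
  simp [Matrix.smul_mulVec]

theorem exists_columns [Finite ι] (A : Matrix m ι F) :
    ∃ (k : ℕ) (g : Fin k → ι), LinearIndependent F (A.col ∘ g) ∧
      ∀ c, A.col c ∈ Submodule.span F (Set.range (A.col ∘ g)) := by
  obtain ⟨κ, a, ha, hsp, hli⟩ := exists_linearIndependent' F A.col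
  have : Finite κ := Finite.of_injective a ha
  obtain ⟨k, ⟨e⟩⟩ := Finite.exists_equiv_fin κ
  refine ⟨k, a ∘ e.symm, hli.comp _ e.symm.injective, fun c => ?_⟩
  rw [← Function.comp_assoc, e.symm.surjective.range_comp, hsp]
  exact Submodule.subset_span ⟨c, rfl⟩

/-- Take columns of `A` forming a basis of the column space, then rows of these forming a basis of
their row space. Equality of row and column rank makes the minor square. -/
theorem exists_spanning_minor [Fintype m] [Fintype ι] (A : Matrix m ι F) :
    ∃ (k : ℕ) (f : Fin k → m) (g : Fin k → ι), (A.submatrix f g).det ≠ 0 ∧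
      ∀ c, A.col c ∈ Submodule.span F (Set.range (A.col ∘ g)) := by
  obtain ⟨k, g, hli, hsp⟩ := exists_columns A
  obtain ⟨k', f, hli', hsp'⟩ := exists_columns (A.submatrix id g)ᵀ
  have h1 : (A.submatrix id g).rank = k := by
    have : LinearIndependent F (A.submatrix id g).col := hli
    rw [rank_eq_finrank_span_cols, finrank_span_eq_card this, Fintype.card_fin]
  have h2 : (A.submatrix id g).rank = k' := by
    rw [← rank_transpose, rank_eq_finrank_span_cols]
    have : Submodule.span F (Set.range (A.submatrix id g)ᵀ.col) =
        Submodule.span F (Set.range ((A.submatrix id g)ᵀ.col ∘ f)) := by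
      apply le_antisymm
      · rw [Submodule.span_le]
        rintro _ ⟨c, rfl⟩
        exact hsp' c
      · exact Submodule.span_mono (Set.range_comp_subset_range _ _)
    rw [this, finrank_span_eq_card hli', Fintype.card_fin]
  obtain rfl : k = k' := h1.symm.trans h2
  refine ⟨k, f, g, ?_, hsp⟩
  have h3 : LinearIndependent F (A.submatrix f g).row := hli'
  rw [linearIndependent_rows_iff_isUnit, isUnit_iff_isUnit_det] at h3
  exact h3.ne_zero

end Minors

/-! ### Echelon form and the number of pivots. -/

section Echelon

open Matrix

variable {F : Type u} [Field F] {d : ℕ} {ι : Type}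

/-- All matrices have a pivotal submatrix such that the associated matrix of minors
is in column echelon form. -/
theorem exists_echelon [Fintype ι] (A : Matrix (Fin d) ι F) :
    ∃ (k : ℕ) (f : Fin k ↪o Fin d) (g : Fin k → ι), IsPivotal A f g ∧
      ∀ i j, i < f j → minorMatrix A f g i j = 0 := by
  classical
  obtain ⟨k, f₀, g, hdet, hspan⟩ := exists_spanning_minor A
  -- The columns `g` stay fixed and the rows are chosen with least index sum. Replacing a row by an
  -- earlier one would lower the sum, so that minor must vanish. Sorting the rows only changes the
  -- sign of the determinant.
  have hex : ∃ N : ℕ, ∃ f : Fin k → Fin d, (A.submatrix f g).det ≠ 0 ∧ ∑ j, (f j).val = N :=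
    ⟨_, f₀, hdet, rfl⟩
  obtain ⟨f₁, hf₁, hN⟩ := Nat.find_spec hex
  have hmin : ∀ f : Fin k → Fin d, (A.submatrix f g).det ≠ 0 →
      ∑ j, (f₁ j).val ≤ ∑ j, (f j).val := fun f hf => hN ▸ Nat.find_min' hex ⟨f, hf, rfl⟩
  have hinj : Function.Injective f₁ := by
    intro i j hij
    by_contra hne
    exact hf₁ (det_zero_of_row_eq hne (by ext c; simp [hij]))
  have hmono : StrictMono (f₁ ∘ Tuple.sort f₁) :=
    (Tuple.monotone_sort f₁).strictMono_of_injective (hinj.comp (Tuple.sort f₁).injective)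
  have hf : (A.submatrix (f₁ ∘ Tuple.sort f₁) g).det ≠ 0 := by
    have : A.submatrix (f₁ ∘ Tuple.sort f₁) g =
        (A.submatrix f₁ g).submatrix (Tuple.sort f₁) id := rfl
    rw [this, det_permute]
    refine mul_ne_zero ?_ hf₁
    rcases Int.units_eq_one_or (Equiv.Perm.sign (Tuple.sort f₁)) with h | h <;> simp [h]
  refine ⟨k, OrderEmbedding.ofStrictMono _ hmono, g, isPivotal_of_span hf hspan, ?_⟩
  intro i j hij
  by_contra hne
  have h1 := hmin _ hne
  have h2 : ∑ l, (f₁ l).val = ∑ l, ((f₁ ∘ Tuple.sort f₁) l).val :=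
    (Equiv.sum_comp (Tuple.sort f₁) fun l => (f₁ l).val).symm
  rw [h2] at h1
  refine absurd h1 (not_le.2 (Finset.sum_lt_sum (fun l _ => ?_) ⟨j, Finset.mem_univ j, ?_⟩))
  · by_cases hl : l = j
    · subst hl; simpa using hij.le
    · simp [hl]
  · simpa using hij

/-- The first columns of a matrix, filled up with zero columns. -/
def padColumns {R : Type*} [Zero R] {k : ℕ} (P : Matrix (Fin d) (Fin k) R) :
    Matrix (Fin d) (Fin d) R :=
  Matrix.of fun i h => if hh : h.val < k then P i ⟨h, hh⟩ else 0

theorem span_padColumns {k : ℕ} (hk : k ≤ d) (P : Matrix (Fin d) (Fin k) F) :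
    Submodule.span F (Set.range (padColumns P).col) = Submodule.span F (Set.range P.col) := by
  apply le_antisymm
  · rw [Submodule.span_le]
    rintro _ ⟨h, rfl⟩
    by_cases hh : h.val < k
    · have : (padColumns P).col h = P.col ⟨h, hh⟩ := by ext i; simp [padColumns, hh]
      rw [this]; exact Submodule.subset_span ⟨_, rfl⟩
    · have : (padColumns P).col h = 0 := by ext i; simp [padColumns, hh]
      rw [this]; exact Submodule.zero_mem _
  · refine Submodule.span_mono ?_
    rintro _ ⟨j, rfl⟩
    exact ⟨Fin.castLE hk j, by ext i; simp [padColumns]⟩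

/-- The rows `f` of the minors form the determinant times the identity, so the inverse determinant
is the normalizing scalar. -/
theorem isWeakNF_padColumns {A : Matrix (Fin d) ι F} {k : ℕ} {f : Fin k ↪o Fin d} {g : Fin k → ι}
    (h : (A.submatrix f g).det ≠ 0) (hlt : ∀ i j, i < f j → minorMatrix A f g i j = 0) :
    IsWeakNF f (padColumns (minorMatrix A f g)) := by
  have hpiv : ∀ j l, minorMatrix A f g (f j) l = if j = l then (A.submatrix f g).det else 0 := by
    intro j l
    have := congrFun (congrFun (minorMatrix_submatrix A f g) j) l
    simpa [one_apply] using this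
  refine ⟨(A.submatrix f g).det⁻¹, inv_ne_zero h, ?_, ?_, ?_⟩
  · intro j c hc
    have hcj : c.val < k := hc ▸ j.isLt
    have hj : (⟨c, hcj⟩ : Fin k) = j := Fin.ext hc
    refine ⟨by simp [padColumns, hcj, hj, hpiv, h], fun i hi => ?_⟩
    simp [padColumns, hcj, hj, hlt i j hi]
  · intro j c hc
    by_cases hcj : c.val < k
    · have hj : j ≠ ⟨c, hcj⟩ := fun e => hc (by rw [e])
      simp [padColumns, hcj, hpiv, hj]
    · simp [padColumns, hcj]
  · intro c hc i
    simp [padColumns, not_lt.2 hc]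

/-- The column span of a matrix in weak normal form with `k` pivots has dimension `k`. -/
theorem IsWeakNF.finrank_span {k : ℕ} {f : Fin k ↪o Fin d} {A : Matrix (Fin d) (Fin d) F}
    (h : IsWeakNF f A) : Module.finrank F (Submodule.span F (Set.range A.col)) = k := by
  obtain ⟨r, hr, h1, h2, h3⟩ := h
  have hk : k ≤ d := by simpa using Fintype.card_le_of_embedding f.toEmbedding
  set P : Matrix (Fin d) (Fin k) F := A.submatrix id (Fin.castLE hk) with hP
  have hA : A = padColumns P := by
    ext i c
    by_cases hc : c.val < k
    · simp [padColumns, hc, hP]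
    · have := h3 c (not_lt.1 hc) i
      simp only [Matrix.smul_apply, smul_eq_mul, mul_eq_zero, hr, false_or] at this
      simp [padColumns, hc, this]
  rw [hA, span_padColumns hk]
  have hli : LinearIndependent F P.col := by
    rw [Fintype.linearIndependent_iff]
    intro x hx j
    -- Row `f j` has its only nonzero entry in column `j`, so it isolates the coefficient `x j`.
    have := congrFun hx (f j)
    simp only [Finset.sum_apply, Pi.smul_apply, smul_eq_mul, Pi.zero_apply, col_apply] at this
    rw [Finset.sum_eq_single j] at this
    · have h4 := (h1 j (Fin.castLE hk j) rfl).1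
      simp only [Matrix.smul_apply, smul_eq_mul] at h4
      refine (mul_eq_zero.1 this).resolve_right fun h0 => ?_
      simp only [hP, submatrix_apply, id] at h0
      simp [h0] at h4
    · intro l _ hl
      have h5 := h2 j (Fin.castLE hk l) (fun e => hl (Fin.ext e))
      simp only [Matrix.smul_apply, smul_eq_mul, mul_eq_zero, hr, false_or] at h5
      simp [hP, h5]
    · simp
  rw [finrank_span_eq_card hli, Fintype.card_fin]

end Echelon

/-! ### Subspaces given as ranges of multiples of projections -/

section ScaledProjections

open Matrix

variable {F : Type u} [Field F] {d : ℕ}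

/-- The nonzero multiple `δ⁻¹ E` of `E` is a projection onto `U`. -/
structure IsScaledProj (δ : F) (E : Matrix (Fin d) (Fin d) F) (U : Submodule F (Fin d → F)) :
    Prop where
  ne_zero : δ ≠ 0
  mulVec_eq : ∀ x ∈ U, E *ᵥ x = δ • x
  mulVec_mem : ∀ x, E *ᵥ x ∈ U

theorem IsScaledProj.span_col {δ : F} {E : Matrix (Fin d) (Fin d) F} {U : Submodule F (Fin d → F)}
    (h : IsScaledProj δ E U) : Submodule.span F (Set.range E.col) = U := by
  rw [← range_mulVecLin]
  apply le_antisymm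
  · rintro _ ⟨x, rfl⟩
    exact h.mulVec_mem x
  · intro x hx
    refine ⟨δ⁻¹ • x, ?_⟩
    rw [mulVecLin_apply, mulVec_smul, h.mulVec_eq x hx, inv_smul_smul₀ h.ne_zero]

/-- A subspace lies in `U` exactly when a projection onto `U` fixes it pointwise, and this need only
be tested on the range of `E'`. Scaling keeps the test free of inverses. -/
theorem IsScaledProj.le_iff {δ δ' : F} {E E' : Matrix (Fin d) (Fin d) F}
    {U U' : Submodule F (Fin d → F)} (h : IsScaledProj δ E U) (h' : IsScaledProj δ' E' U') :
    U' ≤ U ↔ E * E' = δ • E' := by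
  constructor
  · intro hle
    ext i j
    have := congrFun (h.mulVec_eq _ (hle (h'.mulVec_mem (Pi.single j 1)))) i
    rw [mulVec_mulVec, mulVec_single_one, mulVec_single_one] at this
    exact this
  · intro he x hx
    have h1 : E *ᵥ (E' *ᵥ x) = δ • (E' *ᵥ x) := by rw [mulVec_mulVec, he, smul_mulVec]
    rw [h'.mulVec_eq x hx, mulVec_smul, smul_comm] at h1
    have h2 := smul_right_injective _ h'.ne_zero h1
    have h3 : x = δ⁻¹ • (E *ᵥ x) := by rw [h2, inv_smul_smul₀ h.ne_zero]
    rw [h3]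
    exact U.smul_mem _ (h.mulVec_mem x)

/-- `E` extracts the coordinates `f` and applies the minors. On columns of `A` the pivotal identity
says that this is multiplication by the determinant, and linearity extends it to their span. -/
theorem IsPivotal.isScaledProj {ι : Type} {A : Matrix (Fin d) ι F} {k : ℕ} {f : Fin k → Fin d}
    {g : Fin k → ι} (h : IsPivotal A f g) :
    IsScaledProj (A.submatrix f g).det
      (minorMatrix A f g * (1 : Matrix (Fin d) (Fin d) F).submatrix f id)
      (Submodule.span F (Set.range A.col)) := by
  have hE : ∀ x : Fin d → F, (minorMatrix A f g * (1 : Matrix (Fin d) (Fin d) F).submatrix f id) *ᵥ x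
      = minorMatrix A f g *ᵥ (x ∘ f) := by
    intro x
    rw [← mulVec_mulVec]
    congr 1
    ext j
    simp [mulVec, dotProduct, one_apply]
  refine ⟨h.1, fun x hx => ?_, fun x => ?_⟩
  · rw [hE]
    refine Submodule.span_induction (p := fun x _ => minorMatrix A f g *ᵥ (x ∘ f) =
      (A.submatrix f g).det • x) ?_ ?_ ?_ ?_ hx
    · rintro _ ⟨c, rfl⟩
      ext i
      exact (h.2 i c).symm
    · ext i
      simp [mulVec, dotProduct]
    · intro x y _ _ hx hy
      rw [smul_add, ← hx, ← hy, ← mulVec_add]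
      rfl
    · intro c x _ hx
      rw [smul_comm, ← hx, ← mulVec_smul]
      rfl
  · rw [hE, ← h.span_col, ← range_mulVecLin]
    exact ⟨_, rfl⟩

variable [StarRing F]

/-- The form `⟨x | y⟩ = ∑ xᵢ* αᵢ yᵢ` on `F^d`. -/
def diagForm (α : Fin d → F) : (Fin d → F) →ₗ⋆[F] (Fin d → F) →ₗ[F] F :=
  LinearMap.mk₂'ₛₗ (starRingEnd F) (RingHom.id F) (fun x y => ∑ i, star (x i) * α i * y i)
    (fun x y z => by simp [add_mul, Finset.sum_add_distrib])
    (fun c x y => by simp [Finset.mul_sum, mul_assoc, starRingEnd_apply])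
    (fun x y z => by simp [mul_add, Finset.sum_add_distrib])
    (fun c x y => by simp [Finset.mul_sum, mul_left_comm])

theorem diagForm_apply (α x y : Fin d → F) :
    diagForm α x y = ∑ i, star (x i) * α i * y i := rfl

/-- If `P = δ⁻¹ E` projects onto `U`, its adjoint for the form has entries `α_i⁻¹ P_ji* α_j`, and
`1` minus this adjoint projects onto `U^⊥`, even when `U` meets `U^⊥`. The factor `δ* ∏ α_l` clears
the denominators, leaving the product over `l ≠ i` in place of `α_i⁻¹`. -/
theorem IsScaledProj.orthogonal {δ : F} {E : Matrix (Fin d) (Fin d) F}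
    {U : Submodule F (Fin d → F)} (h : IsScaledProj δ E U) {α : Fin d → F} (hα : ∀ i, α i ≠ 0) :
    IsScaledProj (star δ * ∏ i, α i)
      (Matrix.of fun i j => star δ * (∏ l, α l) * (if i = j then 1 else 0) -
        (∏ l ∈ Finset.univ.erase i, α l) * (star (E j i) * α j))
      (U.orthogonalBilin (diagForm α)) := by
  set Δ := ∏ l, α l
  have hQ : ∀ x i, ((Matrix.of fun i j => star δ * Δ * (if i = j then 1 else 0) -
      (∏ l ∈ Finset.univ.erase i, α l) * (star (E j i) * α j)) *ᵥ x) i =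
      star δ * Δ * x i - (∏ l ∈ Finset.univ.erase i, α l) * ∑ j, star (E j i) * α j * x j := by
    intro x i
    simp [mulVec, dotProduct, sub_mul, Finset.mul_sum, mul_assoc]
  refine ⟨mul_ne_zero (star_ne_zero.2 h.ne_zero) (Finset.prod_ne_zero_iff.2 fun i _ => hα i),
    fun x hx => ?_, fun x => ?_⟩
  · ext i
    -- Column `i` of `E` lies in `U`, so orthogonality to it makes the `i`-th adjoint coordinate of
    -- `x` vanish.
    have h1 := hx _ (h.mulVec_mem (Pi.single i 1))
    rw [mulVec_single_one, diagForm_apply] at h1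
    simp only [col_apply] at h1
    rw [hQ, h1]
    simp
  · intro u hu
    -- This is `E u = δ u` under the involution; it moves `E` from one argument of the form to the
    -- other.
    have h1 : ∀ j, star δ * star (u j) = ∑ i, star (u i) * star (E j i) := by
      intro j
      have h2 := congrArg star (congrFun (h.mulVec_eq u hu) j)
      simp only [mulVec, dotProduct, star_sum, star_mul', Pi.smul_apply, smul_eq_mul] at h2
      rw [← h2]
      exact Finset.sum_congr rfl fun i _ => mul_comm _ _
    have h3 : ∀ i, star (u i) * α i * (star δ * Δ * x i - (∏ l ∈ Finset.univ.erase i, α l) *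
        ∑ j, star (E j i) * α j * x j) =
        Δ * (star δ * star (u i) * (α i * x i)) -
          Δ * ∑ j, star (u i) * star (E j i) * (α j * x j) := by
      intro i
      have h4 : α i * ∏ l ∈ Finset.univ.erase i, α l = Δ :=
        Finset.mul_prod_erase _ _ (Finset.mem_univ i)
      have h5 : ∑ j, star (u i) * star (E j i) * (α j * x j) =
          star (u i) * ∑ j, star (E j i) * α j * x j := by
        rw [Finset.mul_sum]
        exact Finset.sum_congr rfl fun j _ => by ring
      rw [h5, ← h4]
      ring
    rw [diagForm_apply]
    simp only [hQ, h3]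
    rw [Finset.sum_sub_distrib, ← Finset.mul_sum, ← Finset.mul_sum, Finset.sum_comm, sub_eq_zero]
    congr 1
    refine Finset.sum_congr rfl fun j _ => ?_
    rw [h1, Finset.sum_mul]

end ScaledProjections

/-! ### Functions and relations uniformly defined by terms and quantifier free formulas -/

section QF

variable {L : FirstOrder.Language.{0, 0}} {γ ι : Type} {n : ℕ}

theorem isQF_foldr_sup {l : List (L.BoundedFormula γ n)} (h : ∀ φ ∈ l, φ.IsQF) :
    (l.foldr (· ⊔ ·) ⊥).IsQF := by
  induction l with
  | nil => exact BoundedFormula.isQF_bot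
  | cons φ l ih =>
    exact (h φ (by simp)).sup (ih fun ψ hψ => h ψ (by simp [hψ]))

theorem isQF_foldr_inf {l : List (L.BoundedFormula γ n)} (h : ∀ φ ∈ l, φ.IsQF) :
    (l.foldr (· ⊓ ·) ⊤).IsQF := by
  induction l with
  | nil => exact BoundedFormula.IsQF.top
  | cons φ l ih =>
    exact (h φ (by simp)).inf (ih fun ψ hψ => h ψ (by simp [hψ]))

theorem isQF_iSup [Finite ι] {φ : ι → L.Formula γ} (h : ∀ i, (φ i).IsQF) :
    (Formula.iSup φ).IsQF :=
  isQF_foldr_sup fun ψ hψ => by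
    obtain ⟨i, -, rfl⟩ := List.mem_map.1 hψ
    exact h i

theorem isQF_iInf [Finite ι] {φ : ι → L.Formula γ} (h : ∀ i, (φ i).IsQF) :
    (Formula.iInf φ).IsQF :=
  isQF_foldr_inf fun ψ hψ => by
    obtain ⟨i, -, rfl⟩ := List.mem_map.1 hψ
    exact h i

theorem IsBasic.isQF {σ : starLang.Formula γ} (h : IsBasic σ) : σ.IsQF := by
  obtain ⟨ps, qs, rfl⟩ := h
  refine isQF_foldr_inf fun φ hφ => ?_
  rcases List.mem_append.1 hφ with h | h
  · obtain ⟨p, -, rfl⟩ := List.mem_map.1 h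
    exact (BoundedFormula.IsAtomic.equal _ _).isQF
  · obtain ⟨q, -, rfl⟩ := List.mem_map.1 h
    exact (BoundedFormula.IsAtomic.equal _ _).isQF.not

/-- Needed for `constantsVarsEquiv.symm`, which turns coefficient variables into constants. -/
theorem isQF_mapTermRel {L' : FirstOrder.Language.{0, 0}} {γ' : Type}
    (ft : ∀ n, L.Term (γ ⊕ Fin n) → L'.Term (γ' ⊕ Fin n))
    (fr : ∀ n, L.Relations n → L'.Relations n) {φ : L.BoundedFormula γ n} (h : φ.IsQF) :
    (φ.mapTermRel (g := id) ft fr (fun _ => id)).IsQF := by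
  induction h with
  | falsum => exact BoundedFormula.isQF_bot
  | of_isAtomic h =>
    cases h with
    | equal t s => exact (BoundedFormula.IsAtomic.equal _ _).isQF
    | rel R ts => exact (BoundedFormula.IsAtomic.rel _ _).isQF
  | imp _ _ h₁ h₂ => exact h₁.imp h₂

theorem isQF_onBoundedFormula {L' : FirstOrder.Language.{0, 0}} (ϕ : L →ᴸ L')
    {φ : L.BoundedFormula γ n} (h : φ.IsQF) : (ϕ.onBoundedFormula φ).IsQF := by
  induction h with
  | falsum => exact BoundedFormula.isQF_bot
  | of_isAtomic h =>
    cases h with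
    | equal t s => exact (BoundedFormula.IsAtomic.equal _ _).isQF
    | rel R ts => exact (BoundedFormula.IsAtomic.rel _ _).isQF
  | imp _ _ h₁ h₂ => exact h₁.imp h₂

theorem isQF_imp_iff {φ ψ : L.BoundedFormula γ n} : (φ.imp ψ).IsQF ↔ φ.IsQF ∧ ψ.IsQF := by
  constructor
  · intro h
    cases h with
    | of_isAtomic h => cases h
    | imp h₁ h₂ => exact ⟨h₁, h₂⟩
  · exact fun h => h.1.imp h.2

end QF

attribute [local instance] starStructure

/-! ### Closure properties of uniform terms, relations and subspaces. -/

section Uniform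

variable {γ : Type}

/-- A function defined for all assignments in all `*`-fields by a single term. -/
def IsTermFun (t : ∀ (F : Type u) [Field F] [StarRing F], (γ → F) → F) : Prop :=
  ∃ s : starLang.Term γ, ∀ (F : Type u) [Field F] [StarRing F] (a : γ → F),
    termVal s a = t F a

namespace IsTermFun

variable {s t : ∀ (F : Type u) [Field F] [StarRing F], (γ → F) → F}

theorem var (i : γ) : IsTermFun.{u} fun F _ _ (a : γ → F) => a i :=
  ⟨Term.var i, fun _ _ _ _ => rfl⟩

theorem zero : IsTermFun.{u} fun F _ _ (_ : γ → F) => (0 : F) :=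
  ⟨Term.func (L := starLang) (l := 0) StarRingFunc.zero Fin.elim0, fun _ _ _ _ => rfl⟩

theorem one : IsTermFun.{u} fun F _ _ (_ : γ → F) => (1 : F) :=
  ⟨Term.func (L := starLang) (l := 0) StarRingFunc.one Fin.elim0, fun _ _ _ _ => rfl⟩

theorem neg (ht : IsTermFun t) : IsTermFun fun F _ _ a => -t F a := by
  obtain ⟨t', h⟩ := ht
  refine ⟨Term.func (L := starLang) (l := 1) StarRingFunc.neg ![t'], fun F _ _ a => ?_⟩
  beta_reduce
  rw [← h]; rfl

theorem star (ht : IsTermFun t) : IsTermFun fun F _ _ a => Star.star (t F a) := by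
  obtain ⟨t', h⟩ := ht
  refine ⟨Term.func (L := starLang) (l := 1) StarRingFunc.star ![t'], fun F _ _ a => ?_⟩
  beta_reduce
  rw [← h]; rfl

theorem add (hs : IsTermFun s) (ht : IsTermFun t) : IsTermFun fun F _ _ a => s F a + t F a := by
  obtain ⟨s', h'⟩ := hs
  obtain ⟨t', h⟩ := ht
  refine ⟨Term.func (L := starLang) (l := 2) StarRingFunc.add ![s', t'], fun F _ _ a => ?_⟩
  beta_reduce
  rw [← h, ← h']; rfl

theorem mul (hs : IsTermFun s) (ht : IsTermFun t) : IsTermFun fun F _ _ a => s F a * t F a := by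
  obtain ⟨s', h'⟩ := hs
  obtain ⟨t', h⟩ := ht
  refine ⟨Term.func (L := starLang) (l := 2) StarRingFunc.mul ![s', t'], fun F _ _ a => ?_⟩
  beta_reduce
  rw [← h, ← h']; rfl

theorem sub (hs : IsTermFun s) (ht : IsTermFun t) : IsTermFun fun F _ _ a => s F a - t F a := by
  simpa only [sub_eq_add_neg] using hs.add ht.neg

/-- The condition involves neither field nor assignment, so it is decided when the term is built. -/
theorem ite (p : Prop) [Decidable p] (hs : IsTermFun s) (ht : IsTermFun t) :
    IsTermFun fun F _ _ a => if p then s F a else t F a := by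
  by_cases h : p <;> simpa [h]

theorem sum {κ : Type} {t : κ → ∀ (F : Type u) [Field F] [StarRing F], (γ → F) → F}
    (K : Finset κ) (ht : ∀ i, IsTermFun (t i)) : IsTermFun fun F _ _ a => ∑ i ∈ K, t i F a := by
  classical
  induction K using Finset.induction_on with
  | empty => simpa using zero
  | insert i K hi ih => simpa [Finset.sum_insert hi] using (ht i).add ih

theorem prod {κ : Type} {t : κ → ∀ (F : Type u) [Field F] [StarRing F], (γ → F) → F}
    (K : Finset κ) (ht : ∀ i, IsTermFun (t i)) : IsTermFun fun F _ _ a => ∏ i ∈ K, t i F a := by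
  classical
  induction K using Finset.induction_on with
  | empty => simpa using one
  | insert i K hi ih => simpa [Finset.prod_insert hi] using (ht i).mul ih

/-- The Leibniz formula has coefficients `1` and `-1` only. -/
theorem det {k : ℕ} {M : ∀ (F : Type u) [Field F] [StarRing F], (γ → F) → Matrix (Fin k) (Fin k) F}
    (hM : ∀ i j, IsTermFun fun F _ _ a => M F a i j) : IsTermFun fun F _ _ a => (M F a).det := by
  simp only [Matrix.det_apply']
  refine sum _ fun p => mul ?_ (prod _ fun i => hM _ _)
  rcases Int.units_eq_one_or (Equiv.Perm.sign p) with h | h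
  · simpa [h] using one
  · simpa [h] using one.neg

theorem minorMatrix {m ι : Type} {k : ℕ}
    {A : ∀ (F : Type u) [Field F] [StarRing F], (γ → F) → Matrix m ι F}
    (hA : ∀ i j, IsTermFun fun F _ _ a => A F a i j) [DecidableEq m] (f : Fin k → m) (g : Fin k → ι)
    (i : m) (j : Fin k) :
    IsTermFun fun F _ _ a => SubspaceLattice.minorMatrix (A F a) f g i j :=
  det (M := fun F _ _ a => (A F a).submatrix (Function.update f j i) g) fun _ _ => hA _ _

end IsTermFun

/-- A relation defined for all assignments in all `*`-fields by a single quantifier free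
formula. -/
def IsQFRel (p : ∀ (F : Type u) [Field F] [StarRing F], (γ → F) → Prop) : Prop :=
  ∃ ψ : starLang.Formula γ, ψ.IsQF ∧ ∀ (F : Type u) [Field F] [StarRing F] (a : γ → F),
    Sat ψ a ↔ p F a

namespace IsQFRel

variable {p q : ∀ (F : Type u) [Field F] [StarRing F], (γ → F) → Prop}
  {s t : ∀ (F : Type u) [Field F] [StarRing F], (γ → F) → F}

theorem eq (hs : IsTermFun s) (ht : IsTermFun t) : IsQFRel fun F _ _ a => s F a = t F a := by
  obtain ⟨s', hs⟩ := hs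
  obtain ⟨t', ht⟩ := ht
  refine ⟨s'.equal t', (BoundedFormula.IsAtomic.equal _ _).isQF, fun F _ _ a => ?_⟩
  beta_reduce
  rw [← hs, ← ht]
  exact Formula.realize_equal

theorem not (hp : IsQFRel p) : IsQFRel fun F _ _ a => ¬ p F a := by
  obtain ⟨φ, hφ, h⟩ := hp
  refine ⟨φ.not, hφ.not, fun F _ _ a => ?_⟩
  beta_reduce
  rw [← h]
  exact Formula.realize_not

theorem and (hp : IsQFRel p) (hq : IsQFRel q) : IsQFRel fun F _ _ a => p F a ∧ q F a := by
  obtain ⟨φ, hφ, h⟩ := hp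
  obtain ⟨ψ, hψ, h'⟩ := hq
  refine ⟨φ ⊓ ψ, hφ.inf hψ, fun F _ _ a => ?_⟩
  beta_reduce
  rw [← h, ← h']
  exact Formula.realize_inf

theorem exists_ {κ : Type} [Finite κ]
    {p : κ → ∀ (F : Type u) [Field F] [StarRing F], (γ → F) → Prop}
    (hp : ∀ i, IsQFRel (p i)) : IsQFRel fun F _ _ a => ∃ i, p i F a := by
  choose φ hφ h using hp
  refine ⟨Formula.iSup φ, isQF_iSup hφ, fun F _ _ a => ?_⟩
  simp only [← h]
  exact Formula.realize_iSup

theorem forall_ {κ : Type} [Finite κ]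
    {p : κ → ∀ (F : Type u) [Field F] [StarRing F], (γ → F) → Prop}
    (hp : ∀ i, IsQFRel (p i)) : IsQFRel fun F _ _ a => ∀ i, p i F a := by
  choose φ hφ h using hp
  refine ⟨Formula.iInf φ, isQF_iInf hφ, fun F _ _ a => ?_⟩
  simp only [← h]
  exact Formula.realize_iInf

theorem isPivotal {m ι : Type} [Finite m] [Finite ι] [DecidableEq m] {k : ℕ}
    {A : ∀ (F : Type u) [Field F] [StarRing F], (γ → F) → Matrix m ι F}
    (hA : ∀ i j, IsTermFun fun F _ _ a => A F a i j) (f : Fin k → m) (g : Fin k → ι) :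
    IsQFRel fun F _ _ a => IsPivotal (A F a) f g := by
  have hdet : IsTermFun fun F _ _ a => ((A F a).submatrix f g).det :=
    .det fun _ _ => hA _ _
  exact (eq hdet .zero).not.and (forall_ fun i => forall_ fun c => eq (hdet.mul (hA _ _))
    (.sum _ fun j => (IsTermFun.minorMatrix hA f g i j).mul (hA _ _)))

end IsQFRel

/-- Subspaces of `F^d` depending on an assignment in a `*`-field which are, by finitely many
quantifier free case distinctions, images of multiples of projections given by terms. The values of
the variables in `D` are required not to vanish. -/
def IsUniformSubspace {d : ℕ} (D : Set γ)
    (U : ∀ (F : Type u) [Field F] [StarRing F], (γ → F) → Submodule F (Fin d → F)) : Prop :=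
  ∃ (κ : Type) (_ : Finite κ) (σ : κ → ∀ (F : Type u) [Field F] [StarRing F], (γ → F) → Prop)
    (δ : κ → ∀ (F : Type u) [Field F] [StarRing F], (γ → F) → F)
    (E : κ → ∀ (F : Type u) [Field F] [StarRing F], (γ → F) → Matrix (Fin d) (Fin d) F),
    (∀ i, IsQFRel (σ i)) ∧ (∀ i, IsTermFun (δ i)) ∧
      (∀ i r s, IsTermFun fun F _ _ a => E i F a r s) ∧
      ∀ (F : Type u) [Field F] [StarRing F] (a : γ → F), (∀ c ∈ D, a c ≠ 0) →
        (∃ i, σ i F a) ∧ ∀ i, σ i F a → IsScaledProj (δ i F a) (E i F a) (U F a)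

namespace IsUniformSubspace

variable {d : ℕ} {D : Set γ}
  {U W : ∀ (F : Type u) [Field F] [StarRing F], (γ → F) → Submodule F (Fin d → F)}

theorem span {ι : Type} [Finite ι]
    {A : ∀ (F : Type u) [Field F] [StarRing F], (γ → F) → Matrix (Fin d) ι F}
    (hA : ∀ i j, IsTermFun fun F _ _ a => A F a i j) :
    IsUniformSubspace D fun F _ _ a => Submodule.span F (Set.range (A F a).col) := by
  have := Fintype.ofFinite ι
  -- One case for each choice of rows and columns; `k ≤ d` suffices because pivot rows are distinct.
  -- Cases may overlap.
  refine ⟨Σ k : Fin (d + 1), (Fin k → Fin d) × (Fin k → ι), inferInstance,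
    fun i F _ _ a => IsPivotal (A F a) i.2.1 i.2.2,
    fun i F _ _ a => ((A F a).submatrix i.2.1 i.2.2).det,
    fun i F _ _ a => minorMatrix (A F a) i.2.1 i.2.2 *
      (1 : Matrix (Fin d) (Fin d) F).submatrix i.2.1 id,
    fun i => .isPivotal hA _ _, fun i => .det fun _ _ => hA _ _, fun i r s => ?_,
    fun F _ _ a _ => ⟨?_, fun i hi => hi.isScaledProj⟩⟩
  · simp only [Matrix.mul_apply, Matrix.submatrix_apply, Matrix.one_apply]
    exact .sum _ fun j => (IsTermFun.minorMatrix hA _ _ _ _).mul (.ite _ .one .zero)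
  · obtain ⟨k, f, g, h, -⟩ := exists_echelon (A F a)
    have hk : k < d + 1 :=
      Nat.lt_succ_of_le (by simpa using Fintype.card_le_of_embedding f.toEmbedding)
    exact ⟨⟨⟨k, hk⟩, f, g⟩, h⟩

/-- In each pair of cases the sum is the column span of the concatenation of `E` and `E'`, whose
entries are terms, so `span` applies again. -/
theorem sup (hU : IsUniformSubspace D U) (hW : IsUniformSubspace D W) :
    IsUniformSubspace D fun F _ _ a => U F a ⊔ W F a := by
  obtain ⟨κ, hκ, σ, δ, E, h1, h2, h3, h4⟩ := hU
  obtain ⟨κ', hκ', σ', δ', E', h1', h2', h3', h4'⟩ := hW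
  have key : ∀ i j, IsUniformSubspace D fun F _ _ a =>
      Submodule.span F (Set.range (Matrix.fromCols (E i F a) (E' j F a)).col) := by
    intro i j
    refine span fun r s => ?_
    rcases s with s | s
    · exact h3 i r s
    · exact h3' j r s
  choose κ₁ hκ₁ τ ε Q k1 k2 k3 k4 using key
  refine ⟨Σ i : κ × κ', κ₁ i.1 i.2, inferInstance,
    fun i F _ _ a => σ i.1.1 F a ∧ σ' i.1.2 F a ∧ τ i.1.1 i.1.2 i.2 F a,
    fun i => ε i.1.1 i.1.2 i.2, fun i => Q i.1.1 i.1.2 i.2,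
    fun i => (h1 _).and ((h1' _).and (k1 _ _ _)), fun i => k2 _ _ _, fun i => k3 _ _ _,
    fun F _ _ a ha => ⟨?_, ?_⟩⟩
  · obtain ⟨i, hi⟩ := (h4 F a ha).1
    obtain ⟨j, hj⟩ := (h4' F a ha).1
    obtain ⟨l, hl⟩ := (k4 i j F a ha).1
    exact ⟨⟨(i, j), l⟩, hi, hj, hl⟩
  · rintro ⟨⟨i, j⟩, l⟩ ⟨hi, hj, hl⟩
    have h := (k4 i j F a ha).2 l hl
    have hr : Set.range (Matrix.fromCols (E i F a) (E' j F a)).col =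
        Set.range (E i F a).col ∪ Set.range (E' j F a).col := by
      ext x
      simp only [Set.mem_range, Set.mem_union, Sum.exists]
      rfl
    beta_reduce at h
    rw [hr, Submodule.span_union, ((h4 F a ha).2 i hi).span_col,
      ((h4' F a ha).2 j hj).span_col] at h
    exact h

theorem orthogonal (hU : IsUniformSubspace D U) (c : Fin d → γ) (hc : ∀ i, c i ∈ D) :
    IsUniformSubspace D fun F _ _ a => (U F a).orthogonalBilin (diagForm fun i => a (c i)) := by
  obtain ⟨κ, hκ, σ, δ, E, h1, h2, h3, h4⟩ := hU
  have hprod : ∀ K : Finset (Fin d), IsTermFun.{u} fun F _ _ (a : γ → F) => ∏ i ∈ K, a (c i) :=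
    fun K => .prod K fun i => .var (c i)
  refine ⟨κ, hκ, σ, fun i F _ _ a => star (δ i F a) * ∏ i, a (c i),
    fun i F _ _ a => Matrix.of fun r s => star (δ i F a) * (∏ l, a (c l)) * (if r = s then 1 else 0) -
      (∏ l ∈ Finset.univ.erase r, a (c l)) * (star (E i F a s r) * a (c s)),
    h1, fun i => (h2 i).star.mul (hprod _), fun i r s => ?_,
    fun F _ _ a ha => ⟨(h4 F a ha).1, fun i hi => ?_⟩⟩
  · exact (((h2 i).star.mul (hprod _)).mul (.ite _ .one .zero)).sub
      ((hprod _).mul ((h3 i s r).star.mul (.var _)))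
  · exact ((h4 F a ha).2 i hi).orthogonal fun l => ha _ (hc l)

/-- Equality is mutual inclusion, tested on the scaled projections. Some case always holds and every
case that holds is correct, so a disjunction over pairs of cases suffices. -/
theorem eq (hU : IsUniformSubspace D U) (hW : IsUniformSubspace D W) :
    ∃ ψ : starLang.Formula γ, ψ.IsQF ∧ ∀ (F : Type u) [Field F] [StarRing F] (a : γ → F),
      (∀ c ∈ D, a c ≠ 0) → (Sat ψ a ↔ U F a = W F a) := by
  obtain ⟨κ, hκ, σ, δ, E, h1, h2, h3, h4⟩ := hU
  obtain ⟨κ', hκ', σ', δ', E', h1', h2', h3', h4'⟩ := hW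
  have hle : ∀ {δ : ∀ (F : Type u) [Field F] [StarRing F], (γ → F) → F}
      {E E' : ∀ (F : Type u) [Field F] [StarRing F], (γ → F) → Matrix (Fin d) (Fin d) F},
      IsTermFun δ → (∀ r s, IsTermFun fun F _ _ a => E F a r s) →
      (∀ r s, IsTermFun fun F _ _ a => E' F a r s) →
      IsQFRel fun F _ _ a => E F a * E' F a = δ F a • E' F a := by
    intro δ E E' hδ hE hE'
    simp only [← Matrix.ext_iff, Matrix.mul_apply, Matrix.smul_apply, smul_eq_mul]
    exact .forall_ fun r => .forall_ fun s =>
      .eq (.sum _ fun l => (hE r l).mul (hE' l s)) (hδ.mul (hE' r s))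
  obtain ⟨ψ, hψ, h⟩ : IsQFRel fun F _ _ (a : γ → F) => ∃ i j, σ i F a ∧ σ' j F a ∧
      E i F a * E' j F a = δ i F a • E' j F a ∧ E' j F a * E i F a = δ' j F a • E i F a :=
    .exists_ fun i => .exists_ fun j => (h1 i).and ((h1' j).and
      ((hle (h2 i) (h3 i) (h3' j)).and (hle (h2' j) (h3' j) (h3 i))))
  refine ⟨ψ, hψ, fun F _ _ a ha => ?_⟩
  rw [h]
  constructor
  · rintro ⟨i, j, hi, hj, he, he'⟩
    have hi := (h4 F a ha).2 i hi
    have hj := (h4' F a ha).2 j hj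
    exact le_antisymm ((hj.le_iff hi).2 he') ((hi.le_iff hj).2 he)
  · intro he
    obtain ⟨i, hi⟩ := (h4 F a ha).1
    obtain ⟨j, hj⟩ := (h4' F a ha).1
    have ki := (h4 F a ha).2 i hi
    have kj := (h4' F a ha).2 j hj
    exact ⟨i, j, hi, hj, (ki.le_iff kj).1 he.ge, (kj.le_iff ki).1 he.le⟩

end IsUniformSubspace

end Uniform

/-! ### Translation of lattice formulas -/

section Translation

variable {d : ℕ} {β : Type}

/-- Variables for the coefficients of a diagonal form and for the matrices `X_k` (`k ∈ β`). -/
abbrev CoordVar (d : ℕ) (β : Type) : Type := Fin d ⊕ (β × Fin d × Fin d)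

/-- The column space of the `k`-th matrix of an assignment. -/
def colSpace {F : Type u} [Field F] (a : CoordVar d β → F) (k : β) : Submodule F (Fin d → F) :=
  Submodule.span F (Set.range
    (Matrix.of fun i j => a (Sum.inr (k, i, j)) : Matrix (Fin d) (Fin d) F).col)

theorem isUniformSubspace_term (t : latLang.Term β) :
    IsUniformSubspace.{u} (Set.range (Sum.inl : Fin d → CoordVar d β)) fun _ _ _ a =>
      letI := latStructure (diagForm fun i => a (Sum.inl i))
      t.realize (colSpace a) := by
  induction t with
  | var k =>
    exact IsUniformSubspace.span
      (A := fun F _ _ a => Matrix.of fun i j => a (Sum.inr (k, i, j))) fun i j => .var _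
  | @func l f ts ih =>
    match l, f with
    | 0, LatFunc.zero =>
      -- The zero subspace is the span of a matrix without columns.
      have h := IsUniformSubspace.span.{u} (D := Set.range (Sum.inl : Fin d → CoordVar d β))
        (A := fun F _ _ a => (0 : Matrix (Fin d) Empty F)) fun i j => .zero
      have h0 : ∀ (F : Type u) [Field F],
          Submodule.span F (Set.range (0 : Matrix (Fin d) Empty F).col) = ⊥ := fun F _ => by
        rw [Set.range_eq_empty, Submodule.span_empty]
      simp only [h0] at h
      exact h
    | 1, LatFunc.perp => exact (ih 0).orthogonal Sum.inl fun i => ⟨i, rfl⟩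
    | 2, LatFunc.join => exact (ih 0).sup (ih 1)

/-- The variables after separation of the entries of the last bound matrix variable. -/
def splitLast {n : ℕ} : CoordVar d (β ⊕ Fin (n + 1)) → CoordVar d (β ⊕ Fin n) ⊕ (Fin d × Fin d)
  | Sum.inl c => Sum.inl (Sum.inl c)
  | Sum.inr (Sum.inl k, p) => Sum.inl (Sum.inr (Sum.inl k, p))
  | Sum.inr (Sum.inr k, p) =>
    Fin.lastCases (motive := fun _ => CoordVar d (β ⊕ Fin n) ⊕ (Fin d × Fin d)) (Sum.inr p)
      (fun k => Sum.inl (Sum.inr (Sum.inr k, p))) k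

/-- The matrix of a projection along a complement. Thus quantifying over matrices reaches all
subspaces. -/
theorem exists_colSpace_eq {F : Type u} [Field F] (U : Submodule F (Fin d → F)) :
    ∃ A : Matrix (Fin d) (Fin d) F, Submodule.span F (Set.range A.col) = U := by
  obtain ⟨p, hp⟩ := Submodule.exists_isCompl U
  refine ⟨LinearMap.toMatrix' (U.subtype ∘ₗ U.projectionOnto p hp), ?_⟩
  rw [← Matrix.range_mulVecLin, ← Matrix.toLin'_apply', Matrix.toLin'_toMatrix',
    LinearMap.range_comp, Submodule.range_projectionOnto, Submodule.map_top, Submodule.range_subtype]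

/-- Lattice formulas interpreted in `F^d` with a diagonal form, uniformly expressed
by the entries of matrices. -/
theorem exists_translation {n : ℕ} (φ : latLang.BoundedFormula β n) :
    ∃ ψ : starLang.Formula (CoordVar d (β ⊕ Fin n)), (φ.IsQF → ψ.IsQF) ∧
      ∀ (F : Type u) [Field F] [StarRing F] (a : CoordVar d (β ⊕ Fin n) → F),
        (∀ i, a (Sum.inl i) ≠ 0) → (Sat ψ a ↔
          letI := latStructure (diagForm fun i => a (Sum.inl i))
          φ.Realize (fun k => colSpace a (Sum.inl k)) (fun k => colSpace a (Sum.inr k))) := by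
  induction φ with
  | falsum =>
    exact ⟨⊥, fun _ => BoundedFormula.isQF_bot, fun F _ _ a _ => Iff.rfl⟩
  | @equal n t₁ t₂ =>
    obtain ⟨ψ, hψ, h⟩ := (isUniformSubspace_term.{u} (d := d) t₁).eq (isUniformSubspace_term t₂)
    refine ⟨ψ, fun _ => hψ, fun F _ _ a ha => ?_⟩
    rw [h F a (by rintro _ ⟨i, rfl⟩; exact ha i)]
    have : colSpace a = Sum.elim (fun k => colSpace a (Sum.inl k))
        (fun k : Fin n => colSpace a (Sum.inr k)) := by
      ext1 k; cases k <;> rfl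
    rw [this]
    rfl
  | rel R => exact R.elim
  | imp φ₁ φ₂ ih₁ ih₂ =>
    obtain ⟨ψ₁, h₁, k₁⟩ := ih₁
    obtain ⟨ψ₂, h₂, k₂⟩ := ih₂
    refine ⟨ψ₁.imp ψ₂, fun h => ?_, fun F _ _ a ha => ?_⟩
    · rw [isQF_imp_iff] at h
      exact (h₁ h.1).imp (h₂ h.2)
    · exact imp_congr (k₁ F a ha) (k₂ F a ha)
  | @all n φ ih =>
    obtain ⟨ψ, -, h⟩ := ih
    -- The bound subspace is replaced by the entries of a matrix spanning it; `splitLast` separates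
    -- these entries as the variables to be quantified.
    refine ⟨Formula.iAlls (Fin d × Fin d) (Formula.relabel splitLast ψ),
      fun h => absurd h (BoundedFormula.not_all_isQF _), fun F _ _ a ha => ?_⟩
    have key : ∀ A : Fin d × Fin d → F, ((Formula.relabel splitLast ψ).Realize (Sum.elim a A) ↔
        letI := latStructure (diagForm fun i => a (Sum.inl i))
        φ.Realize (fun k => colSpace a (Sum.inl k)) (Fin.snoc (fun k => colSpace a (Sum.inr k))
          (Submodule.span F (Set.range
            (Matrix.of fun i j => A (i, j) : Matrix (Fin d) (Fin d) F).col)))) := by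
      intro A
      rw [Formula.realize_relabel]
      refine (h F (Sum.elim a A ∘ splitLast) ha).trans ?_
      have : (fun k => colSpace (Sum.elim a A ∘ splitLast) (Sum.inr k : β ⊕ Fin (n + 1))) =
          Fin.snoc (fun k => colSpace a (Sum.inr k)) (Submodule.span F (Set.range
            (Matrix.of fun i j => A (i, j) : Matrix (Fin d) (Fin d) F).col)) := by
        ext1 k
        refine Fin.lastCases ?_ (fun k => ?_) k
        · simp [colSpace, splitLast]
        · simp [colSpace, splitLast]
      rw [this]
      rfl
    refine Formula.realize_iAlls.trans ?_
    simp only [key]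
    let := latStructure (diagForm fun i => a (Sum.inl i))
    refine Iff.trans ?_ BoundedFormula.realize_all.symm
    constructor
    · intro hA U
      obtain ⟨A, rfl⟩ := exists_colSpace_eq U
      exact hA fun p => A p.1 p.2
    · exact fun hU A => hU _

end Translation

/-! ### Passage between `V` and `F^d` by an orthogonal basis. -/

section Transport

variable {F : Type u} [Field F] [StarRing F] {V : Type v} [AddCommGroup V] [Module F V]

omit [StarRing F] in
theorem spanVia_eq_map {d : ℕ} (b : Module.Basis (Fin d) F V) (A : Matrix (Fin d) (Fin d) F) :
    spanVia b A = (Submodule.span F (Set.range A.col)).map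
      (b.equivFun.symm : (Fin d → F) →ₗ[F] V) := by
  have h : (fun j => ∑ i, A i j • b i) = (b.equivFun.symm : (Fin d → F) →ₗ[F] V) ∘ A.col := by
    funext j
    simp [Module.Basis.equivFun_symm_apply]
  rw [Submodule.map_span, ← Set.range_comp, ← h, spanVia]

omit [StarRing F] in
theorem finrank_spanVia {d : ℕ} (b : Module.Basis (Fin d) F V) (A : Matrix (Fin d) (Fin d) F) :
    Module.finrank F (spanVia b A) = Module.finrank F (Submodule.span F (Set.range A.col)) := by
  rw [spanVia_eq_map]
  exact LinearEquiv.finrank_map_eq b.equivFun.symm _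

variable {B : V →ₗ⋆[F] V →ₗ[F] F} {d : ℕ} [NeZero d] {b : Module.Basis (Fin d) F V} {α : Fin d → F}

/-- Orthogonality kills the mixed terms, and `|v_i| = |v_1| α_i` on the diagonal. -/
theorem form_equivFun_symm (hb : IsPerpBasis B b) (hα : basisForm B b = α) (h0 : α 0 ≠ 0)
    (x y : Fin d → F) :
    B (b.equivFun.symm x) (b.equivFun.symm y) = B (b 0) (b 0) * diagForm α x y := by
  have hB : B (b 0) (b 0) ≠ 0 := by
    intro h
    apply h0
    rw [← hα, basisForm, h, mul_zero]
  have hi : ∀ i, B (b i) (b i) = B (b 0) (b 0) * α i := by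
    intro i
    rw [← hα, basisForm, mul_inv_cancel_left₀ hB]
  rw [diagForm_apply, Finset.mul_sum]
  simp only [Module.Basis.equivFun_symm_apply, map_sum, LinearMap.sum_apply]
  refine Finset.sum_congr rfl fun i _ => ?_
  rw [Finset.sum_eq_single i]
  · simp only [map_smulₛₗ, LinearMap.smul_apply, smul_eq_mul, starRingEnd_apply, RingHom.id_apply]
    rw [hi]
    ring
  · intro j _ hj
    simp [hb j i hj]
  · simp

/-- The isomorphism of subspace lattices with involution given by an orthogonal basis. -/
noncomputable def latticeEquiv (hb : IsPerpBasis B b) (hα : basisForm B b = α) (h0 : α 0 ≠ 0) :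
    letI := latStructure (diagForm α)
    letI := latStructure B
    Submodule F (Fin d → F) ≃[latLang] Submodule F V :=
  letI := latStructure (diagForm α)
  letI := latStructure B
  { toEquiv := (Submodule.orderIsoMapComap b.equivFun.symm).toEquiv
    map_fun' := fun {l} f x => by
      match l, f with
      | 0, LatFunc.zero => exact Submodule.map_bot _
      | 1, LatFunc.perp =>
        have hB : B (b 0) (b 0) ≠ 0 := by
          intro h
          apply h0
          rw [← hα, basisForm, h, mul_zero]
        change Submodule.map (b.equivFun.symm : (Fin d → F) →ₗ[F] V) ((x 0).orthogonalBilin _) =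
          (Submodule.map (b.equivFun.symm : (Fin d → F) →ₗ[F] V) (x 0)).orthogonalBilin B
        ext w
        obtain ⟨y, rfl⟩ := b.equivFun.symm.surjective w
        rw [Submodule.mem_map_equiv, LinearEquiv.symm_symm, LinearEquiv.apply_symm_apply,
          Submodule.mem_orthogonalBilin_iff, Submodule.mem_orthogonalBilin_iff]
        constructor
        · rintro h _ ⟨z, hz, rfl⟩
          have := form_equivFun_symm hb hα h0 z y
          rw [show diagForm α z y = 0 from h z hz, mul_zero] at this
          exact this
        · intro h z hz
          have h1 : B (b.equivFun.symm z) (b.equivFun.symm y) = 0 := h _ ⟨z, hz, rfl⟩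
          rw [form_equivFun_symm hb hα h0] at h1
          exact (mul_eq_zero.1 h1).resolve_left hB
      | 2, LatFunc.join => exact Submodule.map_sup _ _ _
    map_rel' := fun r => r.elim }

/-- Isomorphisms preserve formulas. The right side involves neither the basis nor `B`, so all bases
with the same `ᾱ` give the same answer. -/
theorem mem_latRel_iff (hb : IsPerpBasis B b) (hα : basisForm B b = α) (h0 : α 0 ≠ 0) {n : ℕ}
    (φ : latLang.Formula (Fin n)) (A : Fin n → Matrix (Fin d) (Fin d) F) :
    (fun k => spanVia b (A k)) ∈ latRel B φ ↔
      letI := latStructure (diagForm α)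
      φ.Realize fun k => Submodule.span F (Set.range (A k).col) := by
  let := latStructure (diagForm α)
  let := latStructure B
  rw [← StrongHomClass.realize_formula (latticeEquiv hb hα h0) φ]
  have : (fun k => spanVia b (A k)) =
      ⇑(latticeEquiv hb hα h0) ∘ fun k => Submodule.span F (Set.range (A k).col) :=
    funext fun k => spanVia_eq_map b (A k)
  rw [this]
  rfl

end Transport

/-! ### Elimination of constants from the prime field -/

section PrimeField

variable {F : Type u} [Field F] [StarRing F] {γ : Type} {d : ℕ}

-- The fractions of integers with denominator nonzero in `F` are closed under the field operations.
omit [StarRing F] in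
theorem exists_int_mul_eq {x : F} (hx : x ∈ (⊥ : Subfield F)) :
    ∃ p q : ℤ, (q : F) ≠ 0 ∧ (q : F) * x = p := by
  rw [← Subfield.closure_empty] at hx
  induction hx using Subfield.closure_induction with
  | mem x hx => exact hx.elim
  | one => exact ⟨1, 1, by simp⟩
  | add x y _ _ hx hy =>
    obtain ⟨p, q, hq, h⟩ := hx
    obtain ⟨p', q', hq', h'⟩ := hy
    refine ⟨q' * p + q * p', q * q', by simp [hq, hq'], ?_⟩
    push_cast
    rw [← h, ← h']
    ring
  | neg x _ hx =>
    obtain ⟨p, q, hq, h⟩ := hx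
    exact ⟨-p, q, hq, by push_cast; rw [← h]; ring⟩
  | inv x _ hx =>
    obtain ⟨p, q, hq, h⟩ := hx
    -- The inverse of `0` is `0` by convention; otherwise numerator and denominator trade places.
    by_cases h0 : x = 0
    · exact ⟨0, 1, by simp, by simp [h0]⟩
    · refine ⟨q, p, h ▸ mul_ne_zero hq h0, ?_⟩
      rw [← h, mul_inv_cancel_right₀ h0]
  | mul x y _ _ hx hy =>
    obtain ⟨p, q, hq, h⟩ := hx
    obtain ⟨p', q', hq', h'⟩ := hy
    refine ⟨p * p', q * q', by simp [hq, hq'], ?_⟩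
    push_cast
    rw [← h, ← h']
    ring

theorem isTermFun_intCast (m : ℤ) : IsTermFun.{u} fun F _ _ (_ : γ → F) => (m : F) := by
  induction m using Int.induction_on with
  | zero => simpa using IsTermFun.zero
  | succ n ih => simpa using ih.add .one
  | pred n ih => simpa using ih.sub .one

theorem isTermFun_termVal (t : starLang.Term γ) : IsTermFun.{u} fun _ _ _ a => termVal t a :=
  ⟨t, fun _ _ _ _ => rfl⟩

/-- A common denominator is carried along the term. It is an integer, hence a term itself and fixed
by the involution. The resulting term depends on `F` and `ᾱ`. -/
theorem exists_term_clearing_constants {α : Fin d → F} (hα : ∀ i, α i ∈ (⊥ : Subfield F))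
    (t : starLang.Term (Fin d ⊕ γ)) : ∃ (m : ℤ) (t' : starLang.Term γ), (m : F) ≠ 0 ∧
      ∀ a, termVal t' a = m * termVal t (Sum.elim α a) := by
  induction t with
  | var i =>
    rcases i with i | i
    · obtain ⟨p, q, hq, h⟩ := exists_int_mul_eq (hα i)
      obtain ⟨t', ht'⟩ := isTermFun_intCast.{u} (γ := γ) p
      exact ⟨q, t', hq, fun a => (ht' F a).trans h.symm⟩
    · exact ⟨1, Term.var i, by simp, fun a => by rw [Int.cast_one, one_mul]; rfl⟩
  | @func l f ts ih =>
    choose m t' hm h using ih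
    match l, f with
    | 0, StarRingFunc.zero =>
      obtain ⟨s, hs⟩ := IsTermFun.zero.{u} (γ := γ)
      exact ⟨1, s, by simp, fun a => (hs F a).trans (by rw [Int.cast_one, one_mul]; rfl)⟩
    | 0, StarRingFunc.one =>
      obtain ⟨s, hs⟩ := IsTermFun.one.{u} (γ := γ)
      exact ⟨1, s, by simp, fun a => (hs F a).trans (by rw [Int.cast_one, one_mul]; rfl)⟩
    | 1, StarRingFunc.neg =>
      obtain ⟨s, hs⟩ := (isTermFun_termVal.{u} (t' 0)).neg
      refine ⟨m 0, s, hm 0, fun a => (hs F a).trans ?_⟩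
      beta_reduce
      rw [h, ← mul_neg]; rfl
    | 1, StarRingFunc.star =>
      obtain ⟨s, hs⟩ := (isTermFun_termVal.{u} (t' 0)).star
      refine ⟨m 0, s, hm 0, fun a => (hs F a).trans ?_⟩
      beta_reduce
      rw [h, star_mul', star_intCast]; rfl
    | 2, StarRingFunc.add =>
      obtain ⟨s, hs⟩ := ((isTermFun_intCast.{u} (m 1)).mul (isTermFun_termVal (t' 0))).add
        ((isTermFun_intCast (m 0)).mul (isTermFun_termVal (t' 1)))
      refine ⟨m 0 * m 1, s, by simp [hm], fun a => (hs F a).trans ?_⟩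
      beta_reduce
      rw [h, h]
      have : termVal (Term.func (L := starLang) (l := 2) StarRingFunc.add ts) (Sum.elim α a) =
        termVal (ts 0) (Sum.elim α a) + termVal (ts 1) (Sum.elim α a) := rfl
      refine Eq.trans ?_ (congrArg _ this.symm)
      push_cast
      ring
    | 2, StarRingFunc.mul =>
      obtain ⟨s, hs⟩ := (isTermFun_termVal.{u} (t' 0)).mul (isTermFun_termVal (t' 1))
      refine ⟨m 0 * m 1, s, by simp [hm], fun a => (hs F a).trans ?_⟩
      beta_reduce
      rw [h, h]
      have : termVal (Term.func (L := starLang) (l := 2) StarRingFunc.mul ts) (Sum.elim α a) =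
        termVal (ts 0) (Sum.elim α a) * termVal (ts 1) (Sum.elim α a) := rfl
      refine Eq.trans ?_ (congrArg _ this.symm)
      push_cast
      ring

theorem exists_formula_clearing_constants {α : Fin d → F} (hα : ∀ i, α i ∈ (⊥ : Subfield F))
    {n : ℕ} (φ : starLang.BoundedFormula (Fin d ⊕ γ) n) :
    ∃ ψ : starLang.BoundedFormula γ n, (φ.IsQF → ψ.IsQF) ∧
      ∀ a (x : Fin n → F), ψ.Realize a x ↔ φ.Realize (Sum.elim α a) x := by
  induction φ with
  | falsum => exact ⟨⊥, fun _ => BoundedFormula.isQF_bot, fun a x => Iff.rfl⟩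
  | @equal n t₁ t₂ =>
    have key : ∀ t : starLang.Term ((Fin d ⊕ γ) ⊕ Fin n),
        ∃ (m : ℤ) (t' : starLang.Term (γ ⊕ Fin n)), (m : F) ≠ 0 ∧
          ∀ a x, termVal t' (Sum.elim a x) = m * termVal t (Sum.elim (Sum.elim α a) x) := by
      intro t
      obtain ⟨m, t', hm, h⟩ :=
        -- Bound variables are treated as further free ones while the term is cleared.
        exists_term_clearing_constants hα (t.relabel (Equiv.sumAssoc (Fin d) γ (Fin n)))
      refine ⟨m, t', hm, fun a x => (h _).trans (congrArg _ ?_)⟩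
      refine Term.realize_relabel.trans (congrArg (fun v => termVal t v) (funext fun i => ?_))
      rcases i with (i | i) | i <;> rfl
    obtain ⟨m₁, s₁, hm₁, h₁⟩ := key t₁
    obtain ⟨m₂, s₂, hm₂, h₂⟩ := key t₂
    -- Both sides are brought to the common factor `m₁ m₂`, which cancels as it is nonzero in `F`.
    obtain ⟨r₁, hr₁⟩ := (isTermFun_intCast.{u} m₂).mul (isTermFun_termVal s₁)
    obtain ⟨r₂, hr₂⟩ := (isTermFun_intCast.{u} m₁).mul (isTermFun_termVal s₂)
    refine ⟨r₁.bdEqual r₂, fun _ => (BoundedFormula.IsAtomic.equal _ _).isQF, fun a x => ?_⟩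
    rw [BoundedFormula.realize_bdEqual]
    change termVal r₁ _ = termVal r₂ _ ↔ termVal t₁ _ = termVal t₂ _
    rw [hr₁, hr₂]
    beta_reduce
    rw [h₁, h₂, mul_left_comm, mul_right_inj' hm₁, mul_right_inj' hm₂]
  | rel R => exact R.elim
  | imp φ₁ φ₂ ih₁ ih₂ =>
    obtain ⟨ψ₁, h₁, k₁⟩ := ih₁
    obtain ⟨ψ₂, h₂, k₂⟩ := ih₂
    refine ⟨ψ₁.imp ψ₂, fun h => ?_, fun a x => ?_⟩
    · rw [isQF_imp_iff] at h
      exact (h₁ h.1).imp (h₂ h.2)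
    · exact imp_congr (k₁ a x) (k₂ a x)
  | all φ ih =>
    obtain ⟨ψ, -, h⟩ := ih
    exact ⟨ψ.all, fun h => absurd h (BoundedFormula.not_all_isQF _),
      fun a x => forall_congr' fun y => h a _⟩

/-- Formulas with constants correspond to formulas with additional variables. -/
theorem satPlus_constantsVarsEquiv_symm (α : Fin d → F) (ψ : starLang.Formula (Fin d ⊕ γ))
    (a : γ → F) :
    SatPlus α (BoundedFormula.constantsVarsEquiv.symm ψ) a ↔ Sat ψ (Sum.elim α a) := by
  let := constantsOn.structure α
  have h := BoundedFormula.realize_constantsVarsEquiv (L := starLang) (M := F) (α := Fin d)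
    (φ := BoundedFormula.constantsVarsEquiv.symm ψ) (v := a) (xs := default)
  rw [Equiv.apply_symm_apply] at h
  exact h.symm

end PrimeField

/-! ### The computation of normal forms -/

section NormalForms

/-- Gives the syntactic shape required by `IsBasic` to one inequation (a nonzero minor) and two
families of equations (pivotality and zeros above the pivots). -/
theorem exists_isBasic {γ κ κ' : Type} [Finite κ] [Finite κ']
    {p : κ → ∀ (F : Type u) [Field F] [StarRing F], (γ → F) → F}
    {p' : κ' → ∀ (F : Type u) [Field F] [StarRing F], (γ → F) → F}
    {q : ∀ (F : Type u) [Field F] [StarRing F], (γ → F) → F}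
    (hp : ∀ i, IsTermFun (p i)) (hp' : ∀ i, IsTermFun (p' i)) (hq : IsTermFun q) :
    ∃ σ : starLang.Formula γ, IsBasic σ ∧ ∀ (F : Type u) [Field F] [StarRing F] (a : γ → F),
      Sat σ a ↔ q F a ≠ 0 ∧ (∀ i, p i F a = 0) ∧ ∀ i, p' i F a = 0 := by
  have := Fintype.ofFinite κ
  have := Fintype.ofFinite κ'
  choose t ht using hp
  choose t' ht' using hp'
  obtain ⟨r, hr⟩ := hq
  refine ⟨_, ⟨Finset.univ.toList.map t ++ Finset.univ.toList.map t', [r], rfl⟩, fun F _ _ a => ?_⟩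
  have h0 : ∀ t : starLang.Term γ, (t.equal zeroTerm).Realize a ↔ termVal t a = 0 :=
    fun t => Formula.realize_equal
  refine (BoundedFormula.realize_foldr_inf _ _ _).trans ?_
  simp only [← ht, ← ht', ← hr, List.map_append, List.map_map, List.mem_append, List.mem_map,
    Finset.mem_toList, Finset.mem_univ, true_and, List.map_cons, List.map_nil, List.mem_singleton,
    Function.comp]
  constructor
  · intro h
    exact ⟨fun e => h _ (Or.inr rfl) ((h0 _).2 e),
      fun i => (h0 _).1 (h _ (Or.inl (Or.inl ⟨i, rfl⟩))),
      fun i => (h0 _).1 (h _ (Or.inl (Or.inr ⟨i, rfl⟩)))⟩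
  · rintro ⟨h1, h2, h3⟩ _ ((⟨i, rfl⟩ | ⟨i, rfl⟩) | rfl)
    · exact (h0 _).2 (h2 i)
    · exact (h0 _).2 (h3 i)
    · exact fun e => h1 ((h0 _).1 e)

variable {d : ℕ}

theorem exists_echelon_case {k : ℕ} (f : Fin k ↪o Fin d) (g : Fin k → Fin d) :
    ∃ σ : starLang.Formula (Fin d × Fin d), IsBasic σ ∧
      ∀ (F : Type u) [Field F] [StarRing F] (A : Matrix (Fin d) (Fin d) F),
        Sat σ (fun p => A p.1 p.2) ↔
          IsPivotal A f g ∧ ∀ i j, i < f j → minorMatrix A f g i j = 0 := by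
  have hA : ∀ i j, IsTermFun.{u} fun F _ _ (a : Fin d × Fin d → F) =>
    (Matrix.of fun i j => a (i, j) : Matrix (Fin d) (Fin d) F) i j := fun i j => .var (i, j)
  have hdet : IsTermFun.{u} fun F _ _ (a : Fin d × Fin d → F) =>
    ((Matrix.of fun i j => a (i, j) : Matrix (Fin d) (Fin d) F).submatrix f g).det :=
    .det fun _ _ => hA _ _
  have h1 : ∀ p : Fin d × Fin d, IsTermFun.{u} fun F _ _ (a : Fin d × Fin d → F) =>
      ((Matrix.of fun i j => a (i, j) : Matrix (Fin d) (Fin d) F).submatrix f g).det * a p -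
        ∑ j, minorMatrix (Matrix.of fun i j => a (i, j) : Matrix (Fin d) (Fin d) F) f g p.1 j *
          a (f j, p.2) :=
    fun p => (hdet.mul (.var p)).sub
      (.sum _ fun j => (IsTermFun.minorMatrix hA _ _ _ _).mul (.var _))
  have h2 : ∀ p : Fin d × Fin k, IsTermFun.{u} fun F _ _ (a : Fin d × Fin d → F) =>
      if p.1 < f p.2 then
        minorMatrix (Matrix.of fun i j => a (i, j) : Matrix (Fin d) (Fin d) F) f g p.1 p.2
      else 0 :=
    fun p => .ite _ (IsTermFun.minorMatrix hA _ _ _ _) .zero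
  obtain ⟨σ, hσ, h⟩ := exists_isBasic h1 h2 hdet
  refine ⟨σ, hσ, fun F _ _ A => (h F _).trans ?_⟩
  have hAA : (Matrix.of fun i j => A i j) = A := rfl
  simp only [hAA, Prod.forall, sub_eq_zero, ite_eq_right_iff, IsPivotal, and_assoc, ne_eq]

theorem exists_echelon_terms {k : ℕ} (f : Fin k ↪o Fin d) (g : Fin k → Fin d) :
    ∃ P : Matrix (Fin d) (Fin d) (starLang.Term (Fin d × Fin d)),
      ∀ (F : Type u) [Field F] [StarRing F] (A : Matrix (Fin d) (Fin d) F),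
        (Matrix.of fun i j => termVal (P i j) fun p => A p.1 p.2) =
          padColumns (minorMatrix A f g) := by
  have h : ∀ i j, IsTermFun.{u} fun F _ _ (a : Fin d × Fin d → F) =>
      padColumns (minorMatrix (Matrix.of fun i j => a (i, j) : Matrix (Fin d) (Fin d) F) f g) i j := by
    intro i j
    by_cases hj : j.val < k
    · simp only [padColumns, Matrix.of_apply, hj, dite_true]
      exact .minorMatrix (fun i j => .var (i, j)) _ _ _ _
    · simpa [padColumns, hj] using .zero
  choose P hP using h
  exact ⟨P, fun F _ _ A => by ext i j; exact hP i j F _⟩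

theorem exists_computesNF (d : ℕ) :
    ∃ (S : CaseSystem d) (P : OutputSystem d), ComputesNF.{u} S P := by
  classical
  choose σ hσ h using fun (k : ℕ) (f : Fin k ↪o Fin d) (g : Fin k → Fin d) =>
    exists_echelon_case.{u} f g
  choose P hP using fun (k : ℕ) (f : Fin k ↪o Fin d) (g : Fin k → Fin d) =>
    exists_echelon_terms.{u} f g
  refine ⟨fun k f => Finset.univ.image (σ k f),
    -- Different columns `g` might give the same formula; any of them serves, since the formula
    -- certifies each. Outside `S k f` the zero matrix is a dummy value.
    fun k f s => if hs : ∃ g, σ k f g = s then P k f hs.choose else Matrix.of fun _ _ => zeroTerm,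
    fun k f s hs => ?_, fun F _ _ A => ⟨?_, fun k f s hs hA => ?_⟩⟩
  · obtain ⟨g, -, rfl⟩ := Finset.mem_image.1 hs
    exact hσ k f g
  · obtain ⟨k, f, g, hA⟩ := exists_echelon A
    exact ⟨k, f, σ k f g, Finset.mem_image_of_mem _ (Finset.mem_univ g), (h k f g F A).2 hA⟩
  · obtain ⟨g, -, hg⟩ := Finset.mem_image.1 hs
    have hs : ∃ g, σ k f g = s := ⟨g, hg⟩
    rw [← hs.choose_spec, h] at hA
    simp only [dif_pos hs, hP]
    refine ⟨isWeakNF_padColumns hA.1.1 hA.2, ?_⟩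
    rw [span_padColumns (by simpa using Fintype.card_le_of_embedding f.toEmbedding),
      hA.1.span_col]

variable {S : CaseSystem d} {P : OutputSystem d}

theorem ComputesNF.isQF_rankCond (h : ComputesNF.{u} S P) (l : ℕ) : (rankCond S l).IsQF :=
  isQF_iSup fun p => (h.1 l p.1 _ p.2.2).isQF

/-- Whichever case holds for `A`, its number of pivots is the dimension of the column span. As some
case always holds, the dimension also determines the disjunct. -/
theorem ComputesNF.sat_rankCond (h : ComputesNF.{u} S P) (l : ℕ) {F : Type u} [Field F] [StarRing F]
    (A : Matrix (Fin d) (Fin d) F) : Sat (rankCond S l) (fun p => A p.1 p.2) ↔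
      Module.finrank F (Submodule.span F (Set.range A.col)) = l := by
  refine Formula.realize_iSup.trans ⟨?_, fun hl => ?_⟩
  · rintro ⟨⟨f, σ, hσ⟩, hA⟩
    obtain ⟨h1, h2⟩ := (h.2 F A).2 l f σ hσ hA
    rw [← h2]
    exact h1.finrank_span
  · obtain ⟨k, f, σ, hσ, hA⟩ := (h.2 F A).1
    obtain ⟨h1, h2⟩ := (h.2 F A).2 k f σ hσ hA
    have := h1.finrank_span
    rw [h2, hl] at this
    subst this
    exact ⟨⟨f, σ, hσ⟩, hA⟩

variable {n : ℕ}

theorem ComputesNF.isQF_rankConds (h : ComputesNF.{u} S P) (dd : Fin n → ℕ) :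
    (rankConds S dd).IsQF :=
  isQF_iInf fun k => (h.isQF_rankCond (dd k)).relabel _

theorem ComputesNF.sat_rankConds (h : ComputesNF.{u} S P) (dd : Fin n → ℕ) {F : Type u} [Field F]
    [StarRing F] (A : Fin n → Matrix (Fin d) (Fin d) F) : Sat (rankConds S dd) (matVal A) ↔
      ∀ k, Module.finrank F (Submodule.span F (Set.range (A k).col)) = dd k := by
  refine Formula.realize_iInf.trans (forall_congr' fun k => ?_)
  rw [Formula.realize_relabel, ← h.sat_rankCond]
  rfl

theorem satPlus_toPlus {F : Type u} [Field F] [StarRing F] {γ : Type} (α : Fin d → F)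
    (ψ : starLang.Formula γ) (a : γ → F) : SatPlus α (toPlus ψ) a ↔ Sat ψ a := by
  let := constantsOn.structure α
  exact LHom.realize_onFormula _ ψ

end NormalForms

/-! ### The translation -/

theorem exists_isTranslation (d : ℕ) [NeZero d] : ∃ τ : FormulaMap d, IsTranslation.{u, v} τ := by
  choose ψ hψ h using fun (n : ℕ) (φ : latLang.Formula (Fin n)) =>
    exists_translation.{u} (d := d) φ
  -- A formula has no bound variables outside, so the summand `Fin 0` is dropped. The coefficient
  -- variables then become the constants `c_i`.
  set r : ∀ n, CoordVar d (Fin n ⊕ Fin 0) → Fin d ⊕ MatVar n d :=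
    fun n => Sum.map id (Prod.map (Sum.elim id Fin.elim0) id)
  refine ⟨fun n φ => BoundedFormula.constantsVarsEquiv.symm (Formula.relabel (r n) (ψ n φ)),
    fun n φ hφ => isQF_mapTermRel _ _ ((hψ n φ hφ).relabel _),
    fun F _ _ V _ _ B _ _ α hα n φ => ?_, fun F _ _ α hα n φ => ?_⟩
  · obtain ⟨h1, h2, b, hb, hbα⟩ := hα
    have h0 : α 0 ≠ 0 := (h2 0).2
    have key : ∀ A : Fin n → Matrix (Fin d) (Fin d) F,
        SatPlus α (BoundedFormula.constantsVarsEquiv.symm (Formula.relabel (r n) (ψ n φ)))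
          (matVal A) ↔
        letI := latStructure (diagForm α)
        φ.Realize fun k => Submodule.span F (Set.range (A k).col) := by
      intro A
      rw [satPlus_constantsVarsEquiv_symm]
      refine Formula.realize_relabel.trans
        ((h n φ F (Sum.elim α (matVal A) ∘ r n) fun i => (h2 i).2).trans ?_)
      let := latStructure (diagForm α)
      exact iff_of_eq (congrArg (BoundedFormula.Realize φ _) (Subsingleton.elim _ _))
    ext A
    refine Iff.trans ?_ (key A).symm
    constructor
    · rintro ⟨b, hb, hbα, U, hU, rfl⟩
      exact (mem_latRel_iff hb hbα h0 φ A).1 hU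
    -- Admissibility supplies the basis that `theta` asks for.
    · exact fun hA => ⟨b, hb, hbα, _, (mem_latRel_iff hb hbα h0 φ A).2 hA, rfl⟩
  · obtain ⟨χ, h1, h2⟩ := exists_formula_clearing_constants hα (Formula.relabel (r n) (ψ n φ))
    refine ⟨χ, fun hφ => h1 ((hψ n φ hφ).relabel _), fun a => ?_⟩
    rw [satPlus_constantsVarsEquiv_symm]
    exact h2 a default

/-- Coordinates preserve dimension whatever the basis, so the dimension condition leaves the scope
of the existential over bases. -/
theorem mem_theta_inter_dimTuples {F : Type u} [Field F] [StarRing F] {V : Type v} [AddCommGroup V]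
    [Module F V] (B : V →ₗ⋆[F] V →ₗ[F] F) {d n : ℕ} [NeZero d] (α : Fin d → F)
    (M : Set (Fin n → Submodule F V)) (dd : Fin n → ℕ) (A : Fin n → Matrix (Fin d) (Fin d) F) :
    A ∈ theta B α (M ∩ dimTuples F V dd) ↔ A ∈ theta B α M ∧
      ∀ k, Module.finrank F (Submodule.span F (Set.range (A k).col)) = dd k := by
  constructor
  · rintro ⟨b, hb, hα, U, ⟨hU, hd⟩, rfl⟩
    exact ⟨⟨b, hb, hα, _, hU, rfl⟩, fun k => (finrank_spanVia b (A k)).symm.trans (hd k)⟩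
  · rintro ⟨⟨b, hb, hα, U, hU, rfl⟩, hd⟩
    exact ⟨b, hb, hα, _, ⟨hU, fun k => (finrank_spanVia b (A k)).trans (hd k)⟩, rfl⟩

end SubspaceLattice

theorem corollary9 (d : ℕ) [NeZero d] :
    ∃ (τ : FormulaMap d) (S : CaseSystem d) (P : OutputSystem d),
      IsTranslation.{u, v} τ ∧ ComputesNF.{u} S P ∧ (∀ h ≤ d, (rankCond S h).IsQF) ∧
      ∀ (F : Type u) [Field F] [StarRing F] (V : Type v) [AddCommGroup V] [Module F V]
        (B : V →ₗ⋆[F] V →ₗ[F] F), IsInnerProduct B → Module.finrank F V = d →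
      ∀ α : Fin d → F, Admissible B α →
      ∀ (n : ℕ),
        (∀ φ : latLang.Formula (Fin n),
          (∀ dd : Fin n → ℕ, (∀ k, dd k ≤ d) →
            theta B α (latRel B φ ∩ dimTuples F V dd) =
              matRelPlus α (τ n φ ⊓ toPlus (rankConds S dd))) ∧
          ((∀ i, α i ∈ (⊥ : Subfield F)) →
            ∃ ψ : starLang.Formula (MatVar n d), (φ.IsQF → ψ.IsQF) ∧
              (∀ a : MatVar n d → F, Sat ψ a ↔ SatPlus α (τ n φ) a) ∧
              ∀ dd : Fin n → ℕ, (∀ k, dd k ≤ d) →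
                theta B α (latRel B φ ∩ dimTuples F V dd) = matRel (ψ ⊓ rankConds S dd))) ∧
        ∀ (dd : Fin n → ℕ), (∀ k, dd k ≤ d) →
          ∀ N : Set (Fin n → Submodule F V), QFDefinableRel B dd N →
            (∃ χ : (starLangPlus d).Formula (MatVar n d), χ.IsQF ∧
              theta B α N = matRelPlus α χ) ∧
            ((∀ i, α i ∈ (⊥ : Subfield F)) →
              ∃ χ : starLang.Formula (MatVar n d), χ.IsQF ∧ theta B α N = matRel χ) := by
  obtain ⟨τ, hτ⟩ := exists_isTranslation.{u, v} d
  obtain ⟨S, P, hS⟩ := exists_computesNF.{u} d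
  refine ⟨τ, S, P, hτ, hS, fun h _ => hS.isQF_rankCond h, ?_⟩
  intro F _ _ V _ _ B hB hV α hα n
  have key : ∀ (φ : latLang.Formula (Fin n)) (dd : Fin n → ℕ),
      theta B α (latRel B φ ∩ dimTuples F V dd) =
        matRelPlus α (τ n φ ⊓ toPlus (rankConds S dd)) := by
    intro φ dd
    ext A
    rw [mem_theta_inter_dimTuples, hτ.2.1 F V B hB hV α hα n φ, ← hS.sat_rankConds,
      ← satPlus_toPlus α]
    let := starStructure F
    let := FirstOrder.Language.constantsOn.structure α
    exact FirstOrder.Language.Formula.realize_inf.symm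
  have key' : ∀ (φ : latLang.Formula (Fin n)) (ψ : starLang.Formula (MatVar n d)),
      (∀ a : MatVar n d → F, Sat ψ a ↔ SatPlus α (τ n φ) a) → ∀ dd : Fin n → ℕ,
      theta B α (latRel B φ ∩ dimTuples F V dd) = matRel (ψ ⊓ rankConds S dd) := by
    intro φ ψ hψ dd
    ext A
    rw [mem_theta_inter_dimTuples, hτ.2.1 F V B hB hV α hα n φ, ← hS.sat_rankConds]
    refine (and_congr_left' (hψ (matVal A)).symm).trans ?_
    let := starStructure F
    exact FirstOrder.Language.Formula.realize_inf.symm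
  refine ⟨fun φ => ⟨fun dd _ => key φ dd, fun hp => ?_⟩, ?_⟩
  · obtain ⟨ψ, h1, h2⟩ := hτ.2.2 F α hp n φ
    exact ⟨ψ, h1, h2, fun dd _ => key' φ ψ h2 dd⟩
  · rintro dd - N ⟨φ, hφ, rfl⟩
    refine ⟨⟨_, (hτ.1 n φ hφ).inf (isQF_onBoundedFormula _ (hS.isQF_rankConds dd)), key φ dd⟩,
      fun hp => ?_⟩
    obtain ⟨ψ, h1, h2⟩ := hτ.2.2 F α hp n φ
    exact ⟨_, (h1 hφ).inf (hS.isQF_rankConds dd), key' φ ψ h2 dd⟩
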